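/- Let $n>2$ and $k\ge 0$ be integers, let $\alpha\in(0,1)$, and let $\mathbb R^n$ have its Euclidean metric, with $r(x)=|x|$ and Laplacian $\Delta=d^*d=-\sum_i\partial^2/\partial x_i^2$. Fix a radius function $\rho$ on $\mathbb R^n$, that is, a smooth function $\rho:\mathbb R^n\to[1,\infty)$ such that, for some $R>0$, $\nabla^j(\rho-r)=O(r^{1-n-j})$ on $\{x:r(x)>R\}$ for all $j\ge 0$. For $\beta\in\mathbb R$ and an integer $l\ge 0$, let $C^{l,\alpha}_\beta(\mathbb R^n)$ be the space of $l$ times continuously differentiable functions $f:\mathbb R^n\to\mathbb R$ for which the norm $$\|f\|_{C^{l,\alpha}_\beta}=\sum_{j=0}^{l}\sup_{x}\bigl|\rho(x)^{j-\beta}\nabla^jf(x)\bigr|+\sup_{x\ne y}\Bigl[\min\bigl(\rho(x),\rho(y)\bigr)^{l+\alpha-\beta}\,\frac{|\nabla^lf(x)-\nabla^lf(y)|}{|x-y|^\alpha}\Bigr]$$ is finite, where tensors are measured pointwise in the norm induced by the Euclidean metric. Then: (a) Suppose $\beta\in(-n,-2)$. Then for each $f\in C^{k,\alpha}_\beta(\mathbb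 R^n)$ there is a unique $u\in C^{k+2,\alpha}_{\beta+2}(\mathbb R^n)$ with $\Delta u=f$. (b) Suppose $\beta\in(-1-n,-n)$. Then each $f\in C^{k,\alpha}_\beta(\mathbb R^n)$ is integrable, there exists $u\in C^{k+2,\alpha}_{\beta+2}(\mathbb R^n)$ with $\Delta u=f$ if and only if $\int_{\mathbb R^n}f\,dV=0$, and $u$ is then unique. In each case there is a constant $C>0$, depending only on $n,k,\alpha,\beta$ and the fixed radius function $\rho$ used to define the norms, such that $\|u\|_{C^{k+2,\alpha}_{\beta+2}}\le C\|f\|_{C^{k,\alpha}_\beta}$ whenever $f\in C^{k,\alpha}_\beta(\mathbb R^n)$, $u\in C^{k+2,\alpha}_{\beta+2}(\mathbb R^n)$ and $\Delta u=f$. -/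

import Mathlib

open MeasureTheory
open scoped ENNReal NNReal ContDiff

namespace WeightedHolder

/-- Euclidean `n`-space, with its Euclidean metric. -/
abbrev E (n : ℕ) : Type := EuclideanSpace ℝ (Fin n)

variable {n : ℕ}

/-- The pointwise norm of a covariant `j`-tensor on Euclidean space induced by the Euclidean
metric: the square root of the sum of the squares of its components in the standard
orthonormal basis. -/
noncomputable def tensorNorm {j : ℕ} (T : E n [×j]→L[ℝ] ℝ) : ℝ :=
  √(∑ I : Fin j → Fin n, T (fun i => EuclideanSpace.single (I i) (1 : ℝ)) ^ 2)

/-- A radius function on Euclidean space: a smooth function `ρ` with values in `[1, ∞)` such that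
`∇ʲ(ρ - r) = O(r ^ (1 - n - j))` on `{z | R < r(z)}` for all `j`, where `r(z) = ‖z‖`. -/
structure IsRadiusFunction (ρ : E n → ℝ) : Prop where
  contDiff : ContDiff ℝ ∞ ρ
  one_le : ∀ x, 1 ≤ ρ x
  asymptotic : ∃ R : ℝ, 0 < R ∧ ∀ j : ℕ, ∃ K : ℝ, 0 < K ∧ ∀ z : E n, R < ‖z‖ →
    tensorNorm (iteratedFDeriv ℝ j (fun y : E n => ρ y - ‖y‖) z) ≤
      K * ‖z‖ ^ (1 - (n : ℝ) - (j : ℝ))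

/-- The weighted norm `∑_{j ≤ k} sup |ρ ^ (j - β) ∇ʲ f|`, with values in `[0, ∞]`. It is
meaningful for functions `f` of class `C^k`. -/
noncomputable def weightedCkNorm (ρ : E n → ℝ) (k : ℕ) (β : ℝ) (f : E n → ℝ) : ℝ≥0∞ :=
  ∑ j ∈ Finset.range (k + 1),
    ⨆ x : E n, ENNReal.ofReal (ρ x ^ ((j : ℝ) - β) * tensorNorm (iteratedFDeriv ℝ j f x))

/-- The weighted Hölder seminorm `[T]_{α,γ}` of a `j`-tensor field, with values in `[0, ∞]`:
the supremum over `x ≠ y` of `min (ρ x) (ρ y) ^ (-γ) * |T x - T y| / d(x, y) ^ α`. Since the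
injectivity radius of Euclidean space is infinite, all pairs of distinct points are allowed;
parallel translation along straight segments is the identity. -/
noncomputable def weightedHolderSeminorm (ρ : E n → ℝ) {j : ℕ} (α γ : ℝ)
    (T : E n → E n [×j]→L[ℝ] ℝ) : ℝ≥0∞ :=
  ⨆ (x : E n) (y : E n) (_ : x ≠ y),
    ENNReal.ofReal (min (ρ x) (ρ y) ^ (-γ) * (tensorNorm (T x - T y) / dist x y ^ α))

/-- The norm of the weighted Hölder space `C^{k,α}_β`, with values in `[0, ∞]`. -/
noncomputable def weightedHolderNorm (ρ : E n → ℝ) (k : ℕ) (α β : ℝ) (f : E n → ℝ) : ℝ≥0∞ :=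
  weightedCkNorm ρ k β f +
    weightedHolderSeminorm ρ α (β - (k : ℝ) - α) (fun x => iteratedFDeriv ℝ k f x)

/-- The weighted Hölder space `C^{k,α}_β`: functions of class `C^k` with finite norm. -/
def weightedHolderSpace (ρ : E n → ℝ) (k : ℕ) (α β : ℝ) : Set (E n → ℝ) :=
  {f | ContDiff ℝ (k : ℕ∞) f ∧ weightedHolderNorm ρ k α β f < ⊤}

/-- The Laplacian `d* d = -∑ᵢ ∂²/∂xᵢ²`, with the sign convention of Riemannian geometry that
makes it a nonnegative operator. -/
noncomputable def geomLaplacian (u : E n → ℝ) : E n → ℝ :=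
  fun x => -(Laplacian.laplacian u x)

end WeightedHolder

/-! A solution is built as a superposition over scales, in effect a smooth decomposition of the
Newtonian potential. Write `φ_s(z) = s⁻ⁿ φ(z/s)`. Choose compactly supported smooth `φ`, `η` with `∫
η = 1` and `tr D²φ = -div(z η)` (`exists_isKernelPair`). Scaling then gives `∂_s η_s = s tr D²φ_s`.
For `u = ∫₀^∞ s (φ_s * f) ds` the trace of the Hessian is therefore `∫₀^∞ ∂_s(η_s * f) ds`. This
equals the limit of `η_s * f` at infinity, which is `0`, minus its value `f` at `s = 0`, so `Δu = f`
(`geomLaplacian_potential`).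

The estimates for `u` reduce to estimates for `φ_s * f` at a single scale (`exists_scale_bounds`).
When `s` is small against `1 + |x|`, derivatives of order up to `k` fall on `f` and the others on
the kernel, where the Hölder condition gains `s^α`; the integrand of `u` is then `O(s^(α-1))` near
`s = 0`. When `s` is comparable to `1 + |x|` or larger, the `j`-th derivative of `φ_s * f` is
`O(s^(β-j))`, and `β < -2` makes `s · s^β` integrable at infinity. For `β > -n` this decay only uses
the size of `f`. For `-1-n < β < -n` it requires `∫ f = 0`, since the leading term of the kernel at
large scale must cancel (`exists_far_bound_of_gt`). Integrating in `s` gives the weighted bounds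
(`exists_potential_holderBound`); the Hölder bound for the top derivatives uses one further
derivative at scales above `|x-y|/2`.

Uniqueness is the maximum principle: elements of the target space tend to zero at infinity because
`β + 2 < 0`. That `∫ f = 0` is necessary follows by testing `Δu` against the cutoffs `φ(y/s)` and
moving the Laplacian onto them: the result is `O(s^(β+n))`, which tends to zero
(`integral_geomLaplacian_eq_zero`). By uniqueness the norm bound passes from the constructed
solution to every solution. -/

namespace WeightedHolder

/-! ### Differentiation under the integral sign to finite order. -/

section ParametricIntegral

variable {A V F : Type*} [MeasurableSpace A] {μ : Measure A}
  [NormedAddCommGroup V] [NormedSpace ℝ V] [NormedAddCommGroup F] [NormedSpace ℝ F]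

/-- `continuousMultilinearCurryLeftEquiv` on multilinear maps on a constant family. -/
noncomputable def curryLeftIsometry (V F : Type*) [NormedAddCommGroup V] [NormedSpace ℝ V]
    [NormedAddCommGroup F] [NormedSpace ℝ F] (m : ℕ) :
    (V [×(m + 1)]→L[ℝ] F) ≃ₗᵢ[ℝ] (V →L[ℝ] V [×m]→L[ℝ] F) :=
  continuousMultilinearCurryLeftEquiv ℝ (fun _ : Fin (m + 1) => V) F

theorem fderiv_iteratedFDeriv_eq_curryLeftIsometry (G : V → F) (m : ℕ) (x : V) :
    fderiv ℝ (iteratedFDeriv ℝ m G) x = curryLeftIsometry V F m (iteratedFDeriv ℝ (m + 1) G x) := by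
  rw [fderiv_iteratedFDeriv]
  rfl

/-- Differentiation under the integral sign, to any finite order. -/
theorem contDiff_integral_of_dominated [CompleteSpace F] (N : ℕ) {Φ : A → V → F}
    (hΦ : ∀ᵐ a ∂μ, ContDiff ℝ N (Φ a))
    (hmeas : ∀ j ≤ N, ∀ x, AEStronglyMeasurable (fun a => iteratedFDeriv ℝ j (Φ a) x) μ)
    (hbound : ∀ j ≤ N, ∀ x₀, ∃ ε > 0, ∃ b : A → ℝ, Integrable b μ ∧
      ∀ᵐ a ∂μ, ∀ x ∈ Metric.ball x₀ ε, ‖iteratedFDeriv ℝ j (Φ a) x‖ ≤ b a) :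
    ContDiff ℝ N (fun x => ∫ a, Φ a x ∂μ) ∧ ∀ j ≤ N, ∀ x,
      Integrable (fun a => iteratedFDeriv ℝ j (Φ a) x) μ ∧
      iteratedFDeriv ℝ j (fun x => ∫ a, Φ a x ∂μ) x = ∫ a, iteratedFDeriv ℝ j (Φ a) x ∂μ := by
  have hint : ∀ j ≤ N, ∀ x, Integrable (fun a => iteratedFDeriv ℝ j (Φ a) x) μ := by
    intro j hj x
    obtain ⟨ε, hε, b, hb, h⟩ := hbound j hj x
    exact hb.mono' (hmeas j hj x) (h.mono fun a ha => ha x (Metric.mem_ball_self hε))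
  -- The integrals of the derivatives form a Taylor series for the integral; currying is an isometry
  -- and commutes with integration, so each order reduces to the first-order theorem.
  have key : HasFTaylorSeriesUpTo N (fun x => ∫ a, Φ a x ∂μ)
      (fun x j => ∫ a, iteratedFDeriv ℝ j (Φ a) x ∂μ) := by
    refine ⟨fun x => ?_, fun m hm x => ?_, fun m hm => ?_⟩
    · change (continuousMultilinearCurryFin0 ℝ V F).toContinuousLinearEquiv
        (∫ a, iteratedFDeriv ℝ 0 (Φ a) x ∂μ) = _
      rw [← ContinuousLinearEquiv.integral_comp_comm]
      rfl
    · have hm' : m < N := by exact_mod_cast hm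
      obtain ⟨ε, hε, b, hb, h⟩ := hbound (m + 1) hm' x
      have e1 : curryLeftIsometry V F m (∫ a, iteratedFDeriv ℝ (m + 1) (Φ a) x ∂μ) =
          ∫ a, fderiv ℝ (iteratedFDeriv ℝ m (Φ a)) x ∂μ := by
        refine (ContinuousLinearEquiv.integral_comp_comm (𝕜 := ℝ) (E := V [×(m + 1)]→L[ℝ] F)
          (F := V →L[ℝ] V [×m]→L[ℝ] F) (curryLeftIsometry V F m).toContinuousLinearEquiv
          (fun a => iteratedFDeriv ℝ (m + 1) (Φ a) x)).symm.trans ?_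
        refine integral_congr_ae (Filter.Eventually.of_forall fun a => ?_)
        exact (fderiv_iteratedFDeriv_eq_curryLeftIsometry _ _ _).symm
      change HasFDerivAt _ (curryLeftIsometry V F m
        (∫ a, iteratedFDeriv ℝ (m + 1) (Φ a) x ∂μ)) x
      rw [e1]
      refine hasFDerivAt_integral_of_dominated_of_fderiv_le (bound := b)
        (F' := fun x a => fderiv ℝ (iteratedFDeriv ℝ m (Φ a)) x)
        (Metric.ball_mem_nhds x hε)
        (Filter.Eventually.of_forall fun y => hmeas m hm'.le y) (hint m hm'.le x) ?_ ?_ hb ?_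
      · have := (curryLeftIsometry V F m).continuous.comp_aestronglyMeasurable
          (hmeas (m + 1) hm' x)
        refine this.congr (Filter.Eventually.of_forall fun a => ?_)
        exact (fderiv_iteratedFDeriv_eq_curryLeftIsometry _ _ _).symm
      · filter_upwards [h] with a ha y hy
        rw [norm_fderiv_iteratedFDeriv]
        exact ha y hy
      · filter_upwards [hΦ] with a ha y hy
        exact ((ha.differentiable_iteratedFDeriv (m := m) (by exact_mod_cast hm'))
          y).hasFDerivAt
    · have hm' : m ≤ N := by exact_mod_cast hm
      refine continuous_iff_continuousAt.2 fun x => ?_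
      obtain ⟨ε, hε, b, hb, h⟩ := hbound m hm' x
      refine continuousAt_of_dominated (bound := b)
        (Filter.Eventually.of_forall fun y => hmeas m hm' y) ?_ hb ?_
      · filter_upwards [Metric.ball_mem_nhds x hε] with y hy
        filter_upwards [h] with a ha using ha y hy
      · filter_upwards [hΦ] with a ha
        exact (ha.continuous_iteratedFDeriv (m := m) (by exact_mod_cast hm')).continuousAt
  refine ⟨key.contDiff, fun j hj x => ⟨hint j hj x, ?_⟩⟩
  exact (key.eq_iteratedFDeriv (by exact_mod_cast hj) x).symm

/-- Lets a derivative of order `i + k` be estimated as an `i`-th derivative of the tensor field `D^k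
G`, for which a Hölder condition is available. -/
theorem norm_iteratedFDeriv_iteratedFDeriv (G : V → F) (i k : ℕ) (x : V) :
    ‖iteratedFDeriv ℝ i (iteratedFDeriv ℝ k G) x‖ = ‖iteratedFDeriv ℝ (i + k) G x‖ := by
  induction k generalizing i with
  | zero =>
    rw [iteratedFDeriv_zero_eq_comp, LinearIsometryEquiv.norm_iteratedFDeriv_comp_left, add_zero]
  | succ k ih =>
    have h := LinearIsometryEquiv.norm_iteratedFDeriv_comp_left (𝕜 := ℝ)
      (F := V [×(k + 1)]→L[ℝ] F) (G := V →L[ℝ] V [×k]→L[ℝ] F) (curryLeftIsometry V F k)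
      (iteratedFDeriv ℝ (k + 1) G) x i
    rw [← h, show curryLeftIsometry V F k ∘ iteratedFDeriv ℝ (k + 1) G =
      fderiv ℝ (iteratedFDeriv ℝ k G) from
        funext fun x => (fderiv_iteratedFDeriv_eq_curryLeftIsometry G k x).symm,
      norm_iteratedFDeriv_fderiv, ih, add_right_comm, add_assoc]

end ParametricIntegral

/-! ### Convolution with a compactly supported smooth kernel. -/

section Convolution

variable {n : ℕ} {F : Type*} [NormedAddCommGroup F] [NormedSpace ℝ F]

/-- A smooth kernel supported in the closed ball of radius `r`. -/
structure IsBump (K : E n → ℝ) (r : ℝ) : Prop where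
  contDiff : ContDiff ℝ ∞ K
  eq_zero : ∀ z, r < ‖z‖ → K z = 0

theorem IsBump.hasCompactSupport {K : E n → ℝ} {r : ℝ} (hK : IsBump K r) :
    HasCompactSupport K := by
  refine HasCompactSupport.intro (isCompact_closedBall (0 : E n) r) fun z hz => hK.eq_zero z ?_
  simpa using hz

theorem IsBump.iteratedFDeriv_eq_zero {K : E n → ℝ} {r : ℝ} (hK : IsBump K r) (j : ℕ)
    (z : E n) (hz : r < ‖z‖) : iteratedFDeriv ℝ j K z = 0 := by
  by_contra h
  have h1 := support_iteratedFDeriv_subset (𝕜 := ℝ) (f := K) j (Function.mem_support.2 h)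
  have h2 : tsupport K ⊆ Metric.closedBall 0 r := by
    refine closure_minimal (fun w hw => ?_) Metric.isClosed_closedBall
    by_contra hw'
    exact hw (hK.eq_zero w (by simpa using hw'))
  have := h2 h1
  simp at this
  linarith

theorem IsBump.continuous_iteratedFDeriv {K : E n → ℝ} {r : ℝ} (hK : IsBump K r) (j : ℕ) :
    Continuous (iteratedFDeriv ℝ j K) :=
  hK.contDiff.continuous_iteratedFDeriv (by exact_mod_cast le_top)

theorem IsBump.exists_bound {K : E n → ℝ} {r : ℝ} (hK : IsBump K r) (j : ℕ) :
    ∃ B, 0 < B ∧ ∀ z, ‖iteratedFDeriv ℝ j K z‖ ≤ B := by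
  obtain ⟨B, hB⟩ := (hK.continuous_iteratedFDeriv j).bounded_above_of_compact_support
    (hK.hasCompactSupport.iteratedFDeriv j)
  exact ⟨max B 1, by positivity, fun z => (hB z).trans (le_max_left _ _)⟩

/-- The convolution of the scalar kernel `K` with `g`. -/
noncomputable def mollify (K : E n → ℝ) (g : E n → F) (x : E n) : F :=
  ∫ y, K (x - y) • g y

theorem mollify_eq (K : E n → ℝ) (g : E n → F) (x : E n) :
    mollify K g x = ∫ z, K z • g (x - z) := by
  rw [mollify, ← integral_sub_left_eq_self (fun z => K z • g (x - z)) volume x]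
  simp

theorem iteratedFDeriv_kernel {K : E n → ℝ} {r : ℝ} (hK : IsBump K r) (j : ℕ) (c : F)
    (x y : E n) : iteratedFDeriv ℝ j (fun x => K (x - y) • c) x =
      (iteratedFDeriv ℝ j K (x - y)).smulRight c := by
  have h1 : ContDiff ℝ ∞ (fun x => K (x - y)) := hK.contDiff.comp (contDiff_id.sub contDiff_const)
  rw [iteratedFDeriv_smul_const_apply (h1.contDiffAt.of_le (by exact_mod_cast le_top)),
    iteratedFDeriv_comp_sub]
  ext v
  simp

/-- Derivatives of a convolution fall on the smooth kernel. -/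
theorem mollify_contDiff [CompleteSpace F] {K : E n → ℝ} {r : ℝ} (hK : IsBump K r) {g : E n → F}
    (hg : Continuous g) (N : ℕ) :
    ContDiff ℝ N (mollify K g) ∧ ∀ j ≤ N, ∀ x,
      Integrable (fun y => (iteratedFDeriv ℝ j K (x - y)).smulRight (g y)) ∧
      iteratedFDeriv ℝ j (mollify K g) x =
        ∫ y, (iteratedFDeriv ℝ j K (x - y)).smulRight (g y) := by
  have := contDiff_integral_of_dominated (μ := (volume : Measure (E n))) N
    (Φ := fun y x => K (x - y) • g y) ?_ ?_ ?_
  · simp only [iteratedFDeriv_kernel hK] at this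
    exact this
  · refine Filter.Eventually.of_forall fun y => ?_
    exact ((hK.contDiff.comp (contDiff_id.sub contDiff_const)).smul contDiff_const).of_le
      (by exact_mod_cast le_top)
  · intro j _ x
    simp only [iteratedFDeriv_kernel hK]
    have h1 := hK.continuous_iteratedFDeriv j
    have h2 : Continuous fun y => ContinuousMultilinearMap.smulRightL ℝ (fun _ : Fin j => E n) F
      (iteratedFDeriv ℝ j K (x - y)) (g y) := by fun_prop
    exact h2.aestronglyMeasurable
  · intro j _ x₀
    obtain ⟨B, hB0, hB⟩ := hK.exists_bound j
    refine ⟨1, one_pos, (Metric.closedBall x₀ (1 + r)).indicator fun y => B * ‖g y‖, ?_, ?_⟩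
    · rw [integrable_indicator_iff Metric.isClosed_closedBall.measurableSet]
      exact (continuous_const.mul hg.norm).continuousOn.integrableOn_compact
        (isCompact_closedBall _ _)
    · refine Filter.Eventually.of_forall fun y x hx => ?_
      rw [iteratedFDeriv_kernel hK, ContinuousMultilinearMap.norm_smulRight]
      by_cases hy : y ∈ Metric.closedBall x₀ (1 + r)
      · rw [Set.indicator_of_mem hy]
        gcongr
        exact hB _
      · rw [Set.indicator_of_notMem hy, hK.iteratedFDeriv_eq_zero, norm_zero, zero_mul]
        rw [Metric.mem_closedBall, not_le] at hy
        rw [Metric.mem_ball] at hx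
        rw [← dist_eq_norm]
        have := dist_triangle y x x₀
        rw [dist_comm x y]
        linarith

/-- Derivatives of a convolution fall on the second factor. -/
theorem iteratedFDeriv_mollify_right [CompleteSpace F] {K : E n → ℝ} {r : ℝ} (hK : IsBump K r)
    {g : E n → F} (N : ℕ) (hg : ContDiff ℝ N g) (j : ℕ) (hj : j ≤ N) (x : E n) :
    iteratedFDeriv ℝ j (mollify K g) x = mollify K (iteratedFDeriv ℝ j g) x := by
  have hd : ∀ j ≤ N, ∀ z x, iteratedFDeriv ℝ j (fun x => K z • g (x - z)) x =
      K z • iteratedFDeriv ℝ j g (x - z) := by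
    intro j hj z x
    have h1 : ContDiff ℝ N (fun x => g (x - z)) := hg.comp (contDiff_id.sub contDiff_const)
    rw [iteratedFDeriv_const_smul_apply' (h1.contDiffAt.of_le (by exact_mod_cast hj)),
      iteratedFDeriv_comp_sub]
  have := contDiff_integral_of_dominated (μ := (volume : Measure (E n))) N
    (Φ := fun z x => K z • g (x - z)) ?_ ?_ ?_
  · have h2 := (this.2 j hj x).2
    rw [mollify_eq, show mollify K g = fun x => ∫ z, K z • g (x - z) from
      funext fun x => mollify_eq K g x, h2]
    exact integral_congr_ae (Filter.Eventually.of_forall fun z => hd j hj z x)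
  · refine Filter.Eventually.of_forall fun y => ?_
    exact contDiff_const.smul (hg.comp (contDiff_id.sub contDiff_const))
  · intro j hj x
    simp only [hd j hj]
    have h1 : Continuous (iteratedFDeriv ℝ j g) :=
      hg.continuous_iteratedFDeriv (by exact_mod_cast hj)
    have h0 := hK.contDiff.continuous
    have h2 : Continuous fun z => K z • iteratedFDeriv ℝ j g (x - z) := by fun_prop
    exact h2.aestronglyMeasurable
  · intro j hj x₀
    have h1 : Continuous (iteratedFDeriv ℝ j g) :=
      hg.continuous_iteratedFDeriv (by exact_mod_cast hj)
    obtain ⟨B, hB⟩ := (isCompact_closedBall x₀ (1 + r)).exists_bound_of_continuousOn h1.continuousOn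
    refine ⟨1, one_pos, fun z => ‖K z‖ * B,
      ((hK.contDiff.continuous.integrable_of_hasCompactSupport hK.hasCompactSupport).norm.mul_const
        B), ?_⟩
    refine Filter.Eventually.of_forall fun z x hx => ?_
    rw [hd j hj, norm_smul]
    by_cases hz : r < ‖z‖
    · simp [hK.eq_zero z hz]
    · refine mul_le_mul_of_nonneg_left (hB _ ?_) (norm_nonneg _)
      rw [Metric.mem_ball, dist_eq_norm] at hx
      rw [Metric.mem_closedBall, dist_eq_norm, sub_right_comm]
      calc ‖x - x₀ - z‖ ≤ ‖x - x₀‖ + ‖z‖ := norm_sub_le _ _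
        _ ≤ _ := by linarith

end Convolution

/-! ### Dilated kernels and oscillation bounds at one scale. -/

section Kernels

variable {n : ℕ} {F : Type*} [NormedAddCommGroup F] [NormedSpace ℝ F]

/-- The `L¹`-normalised dilation of a kernel. -/
noncomputable def dilate (K : E n → ℝ) (s : ℝ) (z : E n) : ℝ := (s ^ n)⁻¹ * K (s⁻¹ • z)

theorem IsBump.dilate {K : E n → ℝ} (hK : IsBump K 1) {s : ℝ} (hs : 0 < s) :
    IsBump (dilate K s) s := by
  refine ⟨contDiff_const.mul (hK.contDiff.comp (contDiff_const_smul _)), fun z hz => ?_⟩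
  rw [WeightedHolder.dilate, hK.eq_zero, mul_zero]
  rw [norm_smul, norm_inv, Real.norm_of_nonneg hs.le, inv_mul_eq_div, one_lt_div hs]
  exact hz

theorem iteratedFDeriv_dilate {K : E n → ℝ} (hK : IsBump K 1) (s : ℝ) (j : ℕ) (z : E n) :
    iteratedFDeriv ℝ j (dilate K s) z =
      ((s ^ n)⁻¹ * (s⁻¹) ^ j) • iteratedFDeriv ℝ j K (s⁻¹ • z) := by
  have h1 : ContDiff ℝ j K := hK.contDiff.of_le (by exact_mod_cast le_top)
  have h2 : ContDiff ℝ j fun z => K (s⁻¹ • z) := h1.comp (contDiff_const_smul _)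
  change iteratedFDeriv ℝ j (fun z => (s ^ n)⁻¹ • K (s⁻¹ • z)) z = _
  rw [iteratedFDeriv_const_smul_apply' h2.contDiffAt, iteratedFDeriv_comp_const_smul _ h1, mul_smul]

theorem inv_pow_mul_inv_pow_eq_rpow {s : ℝ} (hs : 0 < s) (m j : ℕ) :
    (s ^ m)⁻¹ * (s⁻¹) ^ j = s ^ (-(m : ℝ) - j) := by
  rw [Real.rpow_sub hs, Real.rpow_neg hs.le, Real.rpow_natCast, Real.rpow_natCast, inv_pow,
    div_eq_mul_inv]

theorem norm_iteratedFDeriv_dilate_le {K : E n → ℝ} (hK : IsBump K 1) {s : ℝ} (hs : 0 < s)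
    {j : ℕ} {B : ℝ} (hB : ∀ z, ‖iteratedFDeriv ℝ j K z‖ ≤ B) (z : E n) :
    ‖iteratedFDeriv ℝ j (dilate K s) z‖ ≤ s ^ (-(n : ℝ) - j) * B := by
  rw [iteratedFDeriv_dilate hK, norm_smul, inv_pow_mul_inv_pow_eq_rpow hs,
    Real.norm_of_nonneg (Real.rpow_nonneg hs.le _)]
  gcongr
  exact hB _

/-- Away from order zero, constants may be subtracted from the convolved function. -/
theorem iteratedFDeriv_mollify_sub_const [CompleteSpace F] {K : E n → ℝ} {r : ℝ}
    (hK : IsBump K r) {g : E n → F} (hg : Continuous g) (j : ℕ) (c : F) (hc : c = 0 ∨ 1 ≤ j)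
    (x : E n) : iteratedFDeriv ℝ j (mollify K g) x =
      ∫ y, (iteratedFDeriv ℝ j K (x - y)).smulRight (g y - c) := by
  obtain ⟨hi, he⟩ := (mollify_contDiff hK hg j).2 j le_rfl x
  rcases hc with rfl | hj
  · simpa using he
  obtain ⟨hi', he'⟩ := (mollify_contDiff hK (continuous_const (y := c)) j).2 j le_rfl x
  -- The mollification of a constant is constant, so its derivatives of order at least one vanish.
  have h0 : mollify K (fun _ => c) = fun _ => ∫ z, K z • c := by
    funext x
    rw [mollify_eq]
  rw [h0, iteratedFDeriv_const_of_ne (by omega)] at he'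
  rw [he, ← sub_zero (∫ y, (iteratedFDeriv ℝ j K (x - y)).smulRight (g y))]
  have h1 : (0 : E n [×j]→L[ℝ] F) = ∫ y, (iteratedFDeriv ℝ j K (x - y)).smulRight c := he'
  rw [h1, ← integral_sub hi hi']
  refine integral_congr_ae (Filter.Eventually.of_forall fun y => ?_)
  ext v
  simp [smul_sub]

/-- Derivatives of a mollification at scale `s` are controlled by the oscillation at scale `s`. -/
theorem IsBump.exists_near_bound [CompleteSpace F] {K : E n → ℝ} (hK : IsBump K 1) (j : ℕ) :
    ∃ C, 0 < C ∧ ∀ (g : E n → F) (c : F) (x : E n) (s D : ℝ), Continuous g → (c = 0 ∨ 1 ≤ j) →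
      0 < s → (∀ y, ‖x - y‖ ≤ s → ‖g y - c‖ ≤ D) →
      ‖iteratedFDeriv ℝ j (mollify (WeightedHolder.dilate K s) g) x‖ ≤ C * s ^ (-(j : ℝ)) * D := by
  obtain ⟨B, hB0, hB⟩ := hK.exists_bound j
  have hω : 0 < volume.real (Metric.ball (0 : E n) 1) :=
    ENNReal.toReal_pos (Metric.measure_ball_pos _ _ one_pos).ne' measure_ball_lt_top.ne
  refine ⟨B * volume.real (Metric.ball (0 : E n) 1), by positivity, ?_⟩
  intro g c x s D hg hc hs hD
  have hKs := hK.dilate hs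
  rw [iteratedFDeriv_mollify_sub_const hKs hg j c hc]
  have hD0 : 0 ≤ D := (norm_nonneg _).trans (hD x (by simpa using hs.le))
  have hsupp : ∀ y ∉ Metric.closedBall x s,
      (iteratedFDeriv ℝ j (WeightedHolder.dilate K s) (x - y)).smulRight (g y - c) = 0 := by
    intro y hy
    rw [← norm_eq_zero, ContinuousMultilinearMap.norm_smulRight, hKs.iteratedFDeriv_eq_zero,
      norm_zero, zero_mul]
    rw [Metric.mem_closedBall, not_le, dist_comm, dist_eq_norm] at hy
    exact hy
  rw [← setIntegral_eq_integral_of_forall_compl_eq_zero hsupp]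
  refine (norm_setIntegral_le_of_norm_le_const (C := s ^ (-(n : ℝ) - j) * B * D)
    measure_closedBall_lt_top ?_).trans (le_of_eq ?_)
  · intro y hy
    rw [ContinuousMultilinearMap.norm_smulRight]
    rw [Metric.mem_closedBall, dist_comm, dist_eq_norm] at hy
    exact mul_le_mul (norm_iteratedFDeriv_dilate_le hK hs hB _) (hD y hy) (norm_nonneg _)
      (by positivity)
  -- The volume `s ^ n` of the support cancels the factor `s ^ (-n)` of the dilated kernel.
  · rw [Measure.real, Measure.addHaar_closedBall _ _ hs.le, finrank_euclideanSpace_fin,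
      ENNReal.toReal_mul, ENNReal.toReal_ofReal (by positivity), ← Measure.real,
      sub_eq_add_neg, Real.rpow_add hs, Real.rpow_neg hs.le, Real.rpow_natCast]
    have : s ^ n ≠ 0 := by positivity
    field_simp

end Kernels

/-! ### Integrals of powers of the weight, and decay at large scales. -/

section Radial

open scoped Pointwise

variable {n : ℕ}

/-- The weight `1 + |x|`. -/
noncomputable def bracket (x : E n) : ℝ := 1 + ‖x‖

theorem one_le_bracket (x : E n) : 1 ≤ bracket x := by simp [bracket]

theorem bracket_pos (x : E n) : 0 < bracket x := one_pos.trans_le (one_le_bracket x)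

@[fun_prop]
theorem continuous_bracket : Continuous (bracket : E n → ℝ) := by
  unfold bracket; fun_prop

theorem continuous_bracket_rpow (γ : ℝ) : Continuous fun x : E n => bracket x ^ γ :=
  continuous_bracket.rpow_const fun x => Or.inl (bracket_pos x).ne'

theorem bracket_rpow_le {γ : ℝ} (hγ : γ ≤ 0) {y : E n} (hy : y ≠ 0) :
    bracket y ^ γ ≤ ‖y‖ ^ γ :=
  Real.rpow_le_rpow_of_nonpos (norm_pos_iff.2 hy) (by simp [bracket]) hγ

theorem setIntegral_norm_rpow_smul {S : Set (E n)} {R : ℝ} (hR : 0 < R) (γ : ℝ) :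
    ∫ y in (R • S : Set (E n)), ‖y‖ ^ γ = R ^ (γ + n) * ∫ y in S, ‖y‖ ^ γ := by
  have h := Measure.setIntegral_comp_smul_of_pos (volume : Measure (E n)) (fun y => ‖y‖ ^ γ) S hR
  have hRn : R ^ n ≠ 0 := by positivity
  rw [finrank_euclideanSpace_fin, eq_inv_smul_iff₀ hRn] at h
  rw [← h, Real.rpow_add hR, Real.rpow_natCast, smul_eq_mul, mul_comm (R ^ γ), mul_assoc]
  congr 1
  rw [← integral_const_mul]
  congr 1
  funext y
  rw [norm_smul, Real.norm_of_nonneg hR.le, Real.mul_rpow hR.le (norm_nonneg _)]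

/-- As `γ ≤ 0`, the weight is dominated by the homogeneous function `‖y‖ ^ γ`, which is locally
integrable for `γ > -n`; scaling reduces to the unit ball. -/
theorem exists_setIntegral_ball_bracket_le (hn : 1 ≤ n) {γ : ℝ} (h1 : -(n : ℝ) < γ) (h2 : γ ≤ 0) :
    ∃ C, 0 < C ∧ ∀ R, 0 < R → ∫ y in Metric.ball (0 : E n) R, bracket y ^ γ ≤ C * R ^ (γ + n) := by
  have hdim : 1 ≤ Module.finrank ℝ (E n) := by simpa using hn
  have := Module.nontrivial_of_finrank_pos (R := ℝ) (M := E n) (by omega)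
  have hint : ∀ R, IntegrableOn (fun y : E n => ‖y‖ ^ γ) (Metric.ball 0 R) := fun R =>
    integrableOn_ball_of_norm_le_rpow (C := 1) (α := -γ) hdim
      (by rw [finrank_euclideanSpace_fin]; linarith)
      (Filter.Eventually.of_forall fun y => by
        rw [neg_neg, one_mul, Real.norm_of_nonneg (by positivity)])
      (measurable_norm.pow_const γ).aestronglyMeasurable
  have h0 : 0 ≤ ∫ y in Metric.ball (0 : E n) 1, ‖y‖ ^ γ :=
    integral_nonneg fun y => by positivity
  refine ⟨(∫ y in Metric.ball (0 : E n) 1, ‖y‖ ^ γ) + 1, by positivity, fun R hR => ?_⟩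
  have hb : Metric.ball (0 : E n) R = R • Metric.ball (0 : E n) 1 := by
    rw [smul_unitBall hR.ne', Real.norm_of_nonneg hR.le]
  calc ∫ y in Metric.ball (0 : E n) R, bracket y ^ γ
      ≤ ∫ y in Metric.ball (0 : E n) R, ‖y‖ ^ γ := by
        refine integral_mono_ae ?_ (hint R) ?_
        · exact ((continuous_bracket_rpow γ).continuousOn.integrableOn_compact
            (isCompact_closedBall 0 R)).mono_set Metric.ball_subset_closedBall
        · refine ae_restrict_of_ae ?_
          filter_upwards [compl_mem_ae_iff.2 (measure_singleton (0 : E n))] with y hy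
          exact bracket_rpow_le h2 hy
    _ = R ^ (γ + n) * ∫ y in Metric.ball (0 : E n) 1, ‖y‖ ^ γ := by
        rw [hb, setIntegral_norm_rpow_smul hR]
    _ ≤ _ := by
        have : 0 < R ^ (γ + n) := Real.rpow_pos_of_pos hR _
        nlinarith

theorem integrable_bracket_rpow {γ : ℝ} (h1 : γ < -(n : ℝ)) :
    Integrable fun y : E n => bracket y ^ γ := by
  have := integrable_one_add_norm (μ := (volume : Measure (E n))) (r := -γ)
    (by rw [finrank_euclideanSpace_fin]; linarith)
  simpa [bracket] using this

theorem exists_setIntegral_compl_ball_bracket_le {γ : ℝ} (h1 : γ < -(n : ℝ)) :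
    ∃ C, 0 < C ∧ ∀ R, 0 < R →
      ∫ y in (Metric.ball (0 : E n) R)ᶜ, bracket y ^ γ ≤ C * R ^ (γ + n) := by
  have hγ : γ < 0 := h1.trans_le (by simp)
  have hne : ∀ {R : ℝ}, 0 < R → ∀ y ∈ (Metric.ball (0 : E n) R)ᶜ, y ≠ 0 := by
    rintro R hR y hy rfl
    simp [hR.not_ge] at hy
  have hint : ∀ R, 0 < R → IntegrableOn (fun y : E n => ‖y‖ ^ γ) (Metric.ball 0 R)ᶜ := by
    intro R hR
    refine Integrable.mono'
      (((integrable_bracket_rpow h1).const_mul ((1 + R⁻¹) ^ (-γ))).integrableOn)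
      (measurable_norm.pow_const γ).aestronglyMeasurable ?_
    refine ae_restrict_of_forall_mem Metric.isOpen_ball.measurableSet.compl fun y hy => ?_
    have hy1 : R ≤ ‖y‖ := by simpa using hy
    have hR' : 0 < 1 + R⁻¹ := by positivity
    rw [Real.norm_of_nonneg (by positivity)]
    have h3 : 1 ≤ R⁻¹ * ‖y‖ := by rwa [inv_mul_eq_div, one_le_div hR]
    have : ((1 + R⁻¹) * ‖y‖) ^ γ ≤ bracket y ^ γ :=
      Real.rpow_le_rpow_of_nonpos (bracket_pos y) (by unfold bracket; linarith) hγ.le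
    rw [Real.mul_rpow hR'.le (norm_nonneg _)] at this
    calc ‖y‖ ^ γ = (1 + R⁻¹) ^ (-γ) * ((1 + R⁻¹) ^ γ * ‖y‖ ^ γ) := by
          rw [← mul_assoc, ← Real.rpow_add hR']; simp
      _ ≤ _ := by gcongr
  have hb : ∀ {R : ℝ}, 0 < R → (Metric.ball (0 : E n) R)ᶜ = R • (Metric.ball (0 : E n) 1)ᶜ := by
    intro R hR
    ext y
    rw [Set.mem_smul_set_iff_inv_smul_mem₀ hR.ne', Set.mem_compl_iff, Set.mem_compl_iff,
      ← Set.mem_smul_set_iff_inv_smul_mem₀ hR.ne', smul_unitBall_of_pos hR]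
  have h0 : 0 ≤ ∫ y in (Metric.ball (0 : E n) 1)ᶜ, ‖y‖ ^ γ :=
    integral_nonneg fun y => by positivity
  refine ⟨(∫ y in (Metric.ball (0 : E n) 1)ᶜ, ‖y‖ ^ γ) + 1, by positivity, fun R hR => ?_⟩
  calc ∫ y in (Metric.ball (0 : E n) R)ᶜ, bracket y ^ γ
      ≤ ∫ y in (Metric.ball (0 : E n) R)ᶜ, ‖y‖ ^ γ := by
        refine setIntegral_mono_on (integrable_bracket_rpow h1).integrableOn (hint R hR)
          Metric.isOpen_ball.measurableSet.compl fun y hy => ?_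
        exact bracket_rpow_le hγ.le (hne hR y hy)
    _ = R ^ (γ + n) * ∫ y in (Metric.ball (0 : E n) 1)ᶜ, ‖y‖ ^ γ := by
        rw [hb hR, setIntegral_norm_rpow_smul hR]
    _ ≤ _ := by
        have : 0 < R ^ (γ + n) := Real.rpow_pos_of_pos hR _
        nlinarith

/-- A continuous function bounded by a weight. -/
theorem integrable_of_le_bracket {f : E n → ℝ} (hf : Continuous f) {M β : ℝ}
    (h : ∀ y, ‖f y‖ ≤ M * bracket y ^ β) (hβ : β < -(n : ℝ)) : Integrable f :=
  ((integrable_bracket_rpow hβ).const_mul M).mono' hf.aestronglyMeasurable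
    (Filter.Eventually.of_forall h)

theorem integrableOn_ball_bracket_rpow (γ R : ℝ) :
    IntegrableOn (fun y : E n => bracket y ^ γ) (Metric.ball 0 R) :=
  ((continuous_bracket_rpow γ).continuousOn.integrableOn_compact
    (isCompact_closedBall 0 R)).mono_set Metric.ball_subset_closedBall

/-- The differentiated kernel has size `s ^ (-n - j)`, and for `β > -n` the mass of the weight on a
ball of radius comparable to `s` is `O(s ^ (β + n))`. No cancellation is needed. -/
theorem exists_far_bound_of_lt {K : E n → ℝ} (hn : 1 ≤ n) (hK : IsBump K 1) (j : ℕ) {β : ℝ}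
    (h1 : -(n : ℝ) < β) (h0 : β ≤ 0) :
    ∃ C, 0 < C ∧ ∀ (f : E n → ℝ) (M : ℝ), Continuous f → 0 ≤ M →
      (∀ y, ‖f y‖ ≤ M * bracket y ^ β) → ∀ (x : E n) (s : ℝ), 0 < s → bracket x ≤ 16 * s →
      ‖iteratedFDeriv ℝ j (mollify (dilate K s) f) x‖ ≤ C * M * s ^ (β - j) := by
  obtain ⟨B, hB0, hB⟩ := hK.exists_bound j
  obtain ⟨C, hC0, hC⟩ := exists_setIntegral_ball_bracket_le hn h1 h0
  refine ⟨B * C * 18 ^ (β + n), by positivity, ?_⟩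
  intro f M hf hM hfM x s hs hx
  have hKs := hK.dilate hs
  have h18 : 0 < 18 * s := by positivity
  rw [((mollify_contDiff hKs hf j).2 j le_rfl x).2]
  -- The kernel vanishes unless `‖y‖ ≤ ‖x‖ + s`, and `‖x‖ + s < 17 * s`.
  rw [← setIntegral_eq_integral_of_forall_compl_eq_zero (s := Metric.ball 0 (18 * s))]
  · calc ‖∫ y in Metric.ball 0 (18 * s),
          (iteratedFDeriv ℝ j (dilate K s) (x - y)).smulRight (f y)‖
        ≤ ∫ y in Metric.ball (0 : E n) (18 * s),
          s ^ (-(n : ℝ) - j) * B * M * bracket y ^ β := by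
          refine norm_integral_le_of_norm_le
            ((integrableOn_ball_bracket_rpow β _).const_mul _)
            (Filter.Eventually.of_forall fun y => ?_)
          rw [ContinuousMultilinearMap.norm_smulRight, mul_assoc _ M]
          exact mul_le_mul (norm_iteratedFDeriv_dilate_le hK hs hB _) (hfM y) (norm_nonneg _)
            (by positivity)
      _ ≤ s ^ (-(n : ℝ) - j) * B * M * (C * (18 * s) ^ (β + n)) := by
          rw [integral_const_mul]
          gcongr
          exact hC _ h18
      _ = B * C * 18 ^ (β + n) * M * (s ^ (-(n : ℝ) - j) * s ^ (β + n)) := by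
          rw [Real.mul_rpow (by norm_num) hs.le]; ring
      _ = _ := by
          rw [← Real.rpow_add hs]
          ring_nf
  · intro y hy
    rw [← norm_eq_zero, ContinuousMultilinearMap.norm_smulRight, hKs.iteratedFDeriv_eq_zero,
      norm_zero, zero_mul]
    rw [mem_ball_zero_iff, not_lt] at hy
    have : ‖y‖ - ‖x‖ ≤ ‖x - y‖ := by
      rw [norm_sub_rev]; exact norm_sub_norm_le _ _
    unfold bracket at hx
    linarith

/-- Since `f` has mean zero, the value of the kernel at `y = 0` may be subtracted. For `‖y‖ < s` the
Lipschitz bound gains `‖y‖ / s`, and `β + 1 > -n` controls the resulting integral; for `‖y‖ ≥ s` the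
tail of the weight is `O(s ^ (β + n))` because `β < -n`. Both pieces are `O(s ^ (β - j))`, whatever
the position of `x`. -/
theorem exists_far_bound_of_gt {K : E n → ℝ} (hn : 2 ≤ n) (hK : IsBump K 1) (j : ℕ) {β : ℝ}
    (h1 : -1 - (n : ℝ) < β) (h0 : β < -(n : ℝ)) :
    ∃ C, 0 < C ∧ ∀ (f : E n → ℝ) (M : ℝ), Continuous f → 0 ≤ M →
      (∀ y, ‖f y‖ ≤ M * bracket y ^ β) → ∫ y, f y = 0 → ∀ (x : E n) (s : ℝ), 0 < s →
      ‖iteratedFDeriv ℝ j (mollify (dilate K s) f) x‖ ≤ C * M * s ^ (β - j) := by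
  have hn' : (2 : ℝ) ≤ n := by exact_mod_cast hn
  obtain ⟨B, hB0, hB⟩ := hK.exists_bound j
  obtain ⟨B', hB'0, hB'⟩ := hK.exists_bound (j + 1)
  obtain ⟨C, hC0, hC⟩ := exists_setIntegral_ball_bracket_le (n := n) (γ := β + 1) (by omega)
    (by linarith) (by linarith)
  obtain ⟨C', hC'0, hC'⟩ := exists_setIntegral_compl_ball_bracket_le h0
  refine ⟨B' * C + 2 * B * C', by positivity, ?_⟩
  intro f M hf hM hfM hf0 x s hs
  have hKs := hK.dilate hs
  obtain ⟨hi, he⟩ := (mollify_contDiff hKs hf j).2 j le_rfl x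
  set k := iteratedFDeriv ℝ j (dilate K s) with hk
  have hfi := integrable_of_le_bracket hf hfM h0
  have hlin : ∀ T : E n [×j]→L[ℝ] ℝ, Integrable (fun y => T.smulRight (f y)) ∧
      ∫ y, T.smulRight (f y) = 0 := by
    intro T
    have e : ∀ y, T.smulRight (f y) = f y • T := fun y => by ext v; simp [mul_comm]
    simp only [e]
    exact ⟨hfi.smul_const T, by rw [integral_smul_const, hf0, zero_smul]⟩
  have he' : iteratedFDeriv ℝ j (mollify (dilate K s) f) x =
      ∫ y, ((k (x - y)).smulRight (f y) - (k x).smulRight (f y)) := by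
    rw [he, integral_sub hi (hlin (k x)).1, (hlin (k x)).2, sub_zero]
  have hdiff : ∀ y, (k (x - y)).smulRight (f y) - (k x).smulRight (f y) =
      (k (x - y) - k x).smulRight (f y) := fun y => by ext v; simp [sub_mul]
  have hkd : Differentiable ℝ k :=
    hKs.contDiff.differentiable_iteratedFDeriv (m := j) (by exact_mod_cast WithTop.coe_lt_top _)
  have hlip : ∀ y, ‖k (x - y) - k x‖ ≤ s ^ (-(n : ℝ) - (j + 1 : ℕ)) * B' * ‖y‖ := by
    intro y
    have := Convex.norm_image_sub_le_of_norm_fderiv_le (𝕜 := ℝ) (f := k) (s := Set.univ)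
      (C := s ^ (-(n : ℝ) - (j + 1 : ℕ)) * B') (x := x) (y := x - y) (fun z _ => hkd z)
      (fun z _ => by
        rw [hk, norm_fderiv_iteratedFDeriv]
        exact norm_iteratedFDeriv_dilate_le hK hs hB' z) convex_univ trivial trivial
    simpa using this
  have hbd : ∀ y, ‖k (x - y) - k x‖ ≤ 2 * (s ^ (-(n : ℝ) - j) * B) := by
    intro y
    refine (norm_sub_le _ _).trans ?_
    have h1 := norm_iteratedFDeriv_dilate_le hK hs hB (x - y)
    have h2 := norm_iteratedFDeriv_dilate_le hK hs hB x
    rw [← hk] at h1 h2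
    linarith
  have hsplit := integral_add_compl
    (f := fun y => (k (x - y)).smulRight (f y) - (k x).smulRight (f y))
    (Metric.isOpen_ball (x := (0 : E n)) (ε := s)).measurableSet (hi.sub (hlin (k x)).1)
  rw [he', ← hsplit]
  have hnear : ‖∫ y in Metric.ball (0 : E n) s,
      ((k (x - y)).smulRight (f y) - (k x).smulRight (f y))‖ ≤
      s ^ (-(n : ℝ) - (j + 1 : ℕ)) * B' * M * (C * s ^ (β + 1 + n)) := by
    calc _ ≤ ∫ y in Metric.ball (0 : E n) s,
          s ^ (-(n : ℝ) - (j + 1 : ℕ)) * B' * M * bracket y ^ (β + 1) := by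
          refine norm_integral_le_of_norm_le
            ((integrableOn_ball_bracket_rpow _ _).const_mul _)
            (Filter.Eventually.of_forall fun y => ?_)
          rw [hdiff, ContinuousMultilinearMap.norm_smulRight]
          calc _ ≤ s ^ (-(n : ℝ) - (j + 1 : ℕ)) * B' * ‖y‖ * (M * bracket y ^ β) :=
                mul_le_mul (hlip y) (hfM y) (norm_nonneg _) (by positivity)
            _ ≤ s ^ (-(n : ℝ) - (j + 1 : ℕ)) * B' * bracket y * (M * bracket y ^ β) := by
                have := bracket_pos y
                gcongr
                simp [bracket]
            _ = _ := by
                rw [Real.rpow_add (bracket_pos y), Real.rpow_one]; ring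
      _ ≤ _ := by
          rw [integral_const_mul]
          gcongr
          exact hC _ hs
  have hfar : ‖∫ y in (Metric.ball (0 : E n) s)ᶜ,
      ((k (x - y)).smulRight (f y) - (k x).smulRight (f y))‖ ≤
      2 * (s ^ (-(n : ℝ) - j) * B) * M * (C' * s ^ (β + n)) := by
    calc _ ≤ ∫ y in (Metric.ball (0 : E n) s)ᶜ,
          2 * (s ^ (-(n : ℝ) - j) * B) * M * bracket y ^ β := by
          refine norm_integral_le_of_norm_le
            ((integrable_bracket_rpow h0).integrableOn.const_mul _)
            (Filter.Eventually.of_forall fun y => ?_)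
          rw [hdiff, ContinuousMultilinearMap.norm_smulRight, mul_assoc _ M]
          exact mul_le_mul (hbd y) (hfM y) (norm_nonneg _) (by positivity)
      _ ≤ _ := by
          rw [integral_const_mul]
          gcongr
          exact hC' _ hs
  refine (norm_add_le _ _).trans ((add_le_add hnear hfar).trans (le_of_eq ?_))
  have e1 : s ^ (-(n : ℝ) - (j + 1 : ℕ)) * s ^ (β + 1 + n) = s ^ (β - j) := by
    rw [← Real.rpow_add hs]; push_cast; ring_nf
  have e2 : s ^ (-(n : ℝ) - j) * s ^ (β + n) = s ^ (β - j) := by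
    rw [← Real.rpow_add hs]; ring_nf
  linear_combination B' * M * C * e1 + 2 * B * M * C' * e2

/-- Decay of mollifications at scales comparable to or larger than the distance to the origin. -/
theorem exists_far_bound {K : E n → ℝ} (hn : 2 ≤ n) (hK : IsBump K 1) (j : ℕ) {β : ℝ}
    (h1 : -1 - (n : ℝ) < β) (h0 : β ≤ 0) (hne : β ≠ -(n : ℝ)) :
    ∃ C, 0 < C ∧ ∀ (f : E n → ℝ) (M : ℝ), Continuous f → 0 ≤ M →
      (∀ y, ‖f y‖ ≤ M * bracket y ^ β) → (β < -(n : ℝ) → ∫ y, f y = 0) →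
      ∀ (x : E n) (s : ℝ), 0 < s → bracket x ≤ 16 * s →
      ‖iteratedFDeriv ℝ j (mollify (dilate K s) f) x‖ ≤ C * M * s ^ (β - j) := by
  rcases lt_or_gt_of_ne hne with h | h
  · obtain ⟨C, hC0, hC⟩ := exists_far_bound_of_gt hn hK j h1 h
    exact ⟨C, hC0, fun f M hf hM hfM h0 x s hs _ => hC f M hf hM hfM (h0 h) x s hs⟩
  · obtain ⟨C, hC0, hC⟩ := exists_far_bound_of_lt (by omega) hK j h h0
    exact ⟨C, hC0, fun f M hf hM hfM _ x s hs hx => hC f M hf hM hfM x s hs hx⟩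

end Radial

/-! ### Bounds for mollifications at every scale. -/

section ScaleBounds

variable {n : ℕ}

/-- Weighted `C^{k,α}` bounds in terms of operator norms and the weight `1 + |x|`; the Hölder
condition is only imposed on pairs of points which are close relative to the weight. -/
structure HolderBound (k : ℕ) (α β M : ℝ) (f : E n → ℝ) : Prop where
  contDiff : ContDiff ℝ k f
  bound : ∀ j ≤ k, ∀ x, ‖iteratedFDeriv ℝ j f x‖ ≤ M * bracket x ^ (β - j)
  holder : ∀ x y, ‖x - y‖ ≤ bracket x / 4 →
    ‖iteratedFDeriv ℝ k f x - iteratedFDeriv ℝ k f y‖ ≤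
      M * bracket x ^ (β - k - α) * ‖x - y‖ ^ α

theorem HolderBound.nonneg {k : ℕ} {α β M : ℝ} {f : E n → ℝ} (h : HolderBound k α β M f) :
    0 ≤ M := by
  have h1 := (norm_nonneg _).trans (h.bound 0 (Nat.zero_le _) 0)
  exact nonneg_of_mul_nonneg_left h1 (Real.rpow_pos_of_pos (bracket_pos _) _)

theorem HolderBound.norm_le {k : ℕ} {α β M : ℝ} {f : E n → ℝ} (h : HolderBound k α β M f)
    (y : E n) : ‖f y‖ ≤ M * bracket y ^ β := by
  simpa using h.bound 0 (Nat.zero_le _) y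

theorem bracket_le_of_near {x y : E n} (h : ‖x - y‖ ≤ bracket x / 4) :
    bracket y ≤ 2 * bracket x ∧ 3 / 4 * bracket x ≤ bracket y := by
  have h1 : ‖y‖ ≤ ‖x‖ + ‖x - y‖ := by
    have := norm_sub_norm_le y x
    rw [norm_sub_rev] at this
    linarith
  have h2 := norm_sub_norm_le x y
  unfold bracket at *
  have := norm_nonneg x
  constructor <;> linarith

theorem rpow_le_of_comparable {a b c : ℝ} (ha : 0 < a) (hb : 0 < b) (hc : 0 < c)
    (h1 : a ≤ c * b) (h2 : b ≤ c * a) (γ : ℝ) : a ^ γ ≤ c ^ |γ| * b ^ γ := by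
  rcases le_total 0 γ with h | h
  · rw [abs_of_nonneg h, ← Real.mul_rpow hc.le hb.le]
    exact Real.rpow_le_rpow ha.le h1 h
  · have h3 : (c * a) ^ γ ≤ b ^ γ := Real.rpow_le_rpow_of_nonpos hb h2 h
    rw [Real.mul_rpow hc.le ha.le] at h3
    rw [abs_of_nonpos h, Real.rpow_neg hc.le, ← div_eq_inv_mul, le_div_iff₀ (by positivity),
      mul_comm]
    exact h3

theorem bracket_rpow_le_of_near {x y : E n} (h : ‖x - y‖ ≤ bracket x / 4) (γ : ℝ) :
    bracket y ^ γ ≤ 2 ^ |γ| * bracket x ^ γ := by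
  obtain ⟨h1, h2⟩ := bracket_le_of_near h
  have := bracket_pos x
  exact rpow_le_of_comparable (bracket_pos y) this two_pos h1 (by linarith) γ

theorem rpow_le_rpow_mul_rpow_of_le {s b : ℝ} (hs : 0 < s) (hb : s ≤ b) {p : ℝ} (hp : 0 ≤ p)
    (q r : ℝ) : s ^ (r + p) * b ^ q ≤ s ^ r * b ^ (q + p) := by
  have hb0 := hs.trans_le hb
  rw [Real.rpow_add hs, Real.rpow_add hb0]
  have := Real.rpow_le_rpow hs.le hb hp
  calc s ^ r * s ^ p * b ^ q ≤ s ^ r * b ^ p * b ^ q := by gcongr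
    _ = _ := by ring

variable {k : ℕ} {α β : ℝ} {φ : E n → ℝ}

/-- All derivatives fall on `f`, and the average only involves points whose weight is comparable to
that of `x`. -/
theorem exists_small_scale_bound_low (hφ : IsBump φ 1) (j : ℕ) (hj : j ≤ k) :
    ∃ C, 0 < C ∧ ∀ (f : E n → ℝ) (M : ℝ), HolderBound k α β M f → ∀ (x : E n) (s : ℝ), 0 < s →
      s ≤ bracket x / 4 →
      ‖iteratedFDeriv ℝ j (mollify (dilate φ s) f) x‖ ≤ C * M * bracket x ^ (β - j) := by
  obtain ⟨C, hC0, hC⟩ := hφ.exists_near_bound (F := E n [×j]→L[ℝ] ℝ) 0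
  refine ⟨C * 2 ^ |β - j|, by positivity, fun f M hf x s hs hsx => ?_⟩
  rw [iteratedFDeriv_mollify_right (hφ.dilate hs) k hf.contDiff j hj]
  have h := hC (iteratedFDeriv ℝ j f) 0 x s (M * (2 ^ |β - j| * bracket x ^ (β - j)))
    (hf.contDiff.continuous_iteratedFDeriv (by exact_mod_cast hj)) (Or.inl rfl) hs
    (fun y hy => by
      rw [sub_zero]
      refine (hf.bound j hj y).trans ?_
      have := hf.nonneg
      gcongr
      exact bracket_rpow_le_of_near (hy.trans hsx) _)
  rw [norm_iteratedFDeriv_zero] at h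
  refine h.trans (le_of_eq ?_)
  simp
  ring

/-- With `k` derivatives on `f` and `i ≥ 1` on the kernel, the constant `D^k f(x)` can be
subtracted, so the Hölder condition turns `s ^ (-i)` into `s ^ (α - i)`. -/
theorem exists_small_scale_bound_high (hα : 0 < α) (hφ : IsBump φ 1) (i : ℕ) (hi : 1 ≤ i) :
    ∃ C, 0 < C ∧ ∀ (f : E n → ℝ) (M : ℝ), HolderBound k α β M f → ∀ (x : E n) (s : ℝ), 0 < s →
      s ≤ bracket x / 4 →
      ‖iteratedFDeriv ℝ (i + k) (mollify (dilate φ s) f) x‖ ≤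
        C * M * (s ^ (α - i) * bracket x ^ (β - k - α)) := by
  obtain ⟨C, hC0, hC⟩ := hφ.exists_near_bound (F := E n [×k]→L[ℝ] ℝ) i
  refine ⟨C, by positivity, fun f M hf x s hs hsx => ?_⟩
  rw [← norm_iteratedFDeriv_iteratedFDeriv, show iteratedFDeriv ℝ k (mollify (dilate φ s) f) =
    mollify (dilate φ s) (iteratedFDeriv ℝ k f) from
      funext fun x => iteratedFDeriv_mollify_right (hφ.dilate hs) k hf.contDiff k le_rfl x]
  have := hf.nonneg
  have hb := bracket_pos x
  have h := hC (iteratedFDeriv ℝ k f) (iteratedFDeriv ℝ k f x) x s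
    (M * bracket x ^ (β - k - α) * s ^ α)
    (hf.contDiff.continuous_iteratedFDeriv (by exact_mod_cast le_rfl)) (Or.inr hi) hs
    (fun y hy => by
      rw [norm_sub_rev]
      refine (hf.holder x y (hy.trans hsx)).trans ?_
      gcongr)
  refine h.trans (le_of_eq ?_)
  rw [sub_eq_add_neg α, Real.rpow_add hs]
  ring

/-- The estimates for mollifications at all scales on which the solution theory rests. -/
theorem exists_scale_bounds (hn : 2 ≤ n) (hα : α ∈ Set.Ioo (0 : ℝ) 1) (hφ : IsBump φ 1)
    (h1 : -1 - (n : ℝ) < β) (h0 : β < -2) (hne : β ≠ -(n : ℝ)) :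
    ∃ C, 0 < C ∧ ∀ (f : E n → ℝ) (M : ℝ), HolderBound k α β M f →
      (β < -(n : ℝ) → ∫ y, f y = 0) → ∀ (x : E n) (s : ℝ), 0 < s →
      (∀ j ≤ k + 2, s ≤ bracket x / 4 → ‖iteratedFDeriv ℝ j (mollify (dilate φ s) f) x‖ ≤
        C * M * (s ^ (α - 2) * bracket x ^ (β + 2 - j - α))) ∧
      (∀ j ≤ k + 2, bracket x ≤ 16 * s → ‖iteratedFDeriv ℝ j (mollify (dilate φ s) f) x‖ ≤
        C * M * s ^ (β - j)) ∧
      ‖iteratedFDeriv ℝ (k + 3) (mollify (dilate φ s) f) x‖ ≤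
        C * M * (s ^ (α - 3) * bracket x ^ (β - k - α)) := by
  obtain ⟨hα0, hα1⟩ := hα
  have hlow : ∀ j, ∃ C, 0 < C ∧ (j ≤ k → ∀ (f : E n → ℝ) (M : ℝ), HolderBound k α β M f →
      ∀ (x : E n) (s : ℝ), 0 < s → s ≤ bracket x / 4 →
      ‖iteratedFDeriv ℝ j (mollify (dilate φ s) f) x‖ ≤ C * M * bracket x ^ (β - j)) := by
    intro j
    by_cases hj : j ≤ k
    · obtain ⟨C, hC0, hC⟩ := exists_small_scale_bound_low (α := α) (β := β) hφ j hj
      exact ⟨C, hC0, fun _ => hC⟩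
    · exact ⟨1, one_pos, fun h => absurd h hj⟩
  choose A hA0 hA using hlow
  obtain ⟨A1, hA10, hA1⟩ := exists_small_scale_bound_high (k := k) (β := β) hα0 hφ 1 le_rfl
  obtain ⟨A2, hA20, hA2⟩ := exists_small_scale_bound_high (k := k) (β := β) hα0 hφ 2 (by norm_num)
  obtain ⟨A3, hA30, hA3⟩ := exists_small_scale_bound_high (k := k) (β := β) hα0 hφ 3 (by norm_num)
  choose D hD0 hD using fun j => exists_far_bound hn hφ j h1 (by linarith) hne
  set S := ∑ j ∈ Finset.range (k + 4), (A j + D j) with hS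
  have hSj : ∀ j < k + 4, A j + D j ≤ S := fun j hj =>
    Finset.single_le_sum (f := fun j => A j + D j)
      (fun i _ => (add_pos (hA0 i) (hD0 i)).le) (Finset.mem_range.2 hj)
  have hS0 : 0 < S := (add_pos (hA0 0) (hD0 0)).trans_le (hSj 0 (by omega))
  set W : ℝ := 16 ^ (-(β - k - α)) with hW
  have hkα : β - k - α < 0 := by
    have : (0 : ℝ) ≤ k := Nat.cast_nonneg k
    linarith
  have hW0 : 0 < W := by positivity
  refine ⟨S + A1 + A2 + A3 + S * W, by positivity, fun f M hf hf0 x s hs => ?_⟩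
  have hM := hf.nonneg
  have hb := bracket_pos x
  have hcont := hf.contDiff.continuous
  have mono : ∀ {a Q R : ℝ}, a ≤ S + A1 + A2 + A3 + S * W → 0 ≤ Q → Q ≤ R → 0 ≤ a →
      a * M * Q ≤ (S + A1 + A2 + A3 + S * W) * M * R := by
    intro a Q R ha hQ hR ha0
    have := ha0.trans ha
    gcongr
  have hSW : 0 < S * W := by positivity
  refine ⟨fun j hj hsx => ?_, fun j hj hsx => ?_, ?_⟩
  · have hsx' : s ≤ bracket x := by linarith
    rcases Nat.lt_or_ge k j with hkj | hkj
    · obtain rfl | rfl : j = 1 + k ∨ j = 2 + k := by omega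
      · refine (hA1 f M hf x s hs hsx).trans (mono (by linarith) (by positivity) ?_ hA10.le)
        have := rpow_le_rpow_mul_rpow_of_le hs hsx' zero_le_one (β - k - α) (α - 2)
        convert this using 3 <;> push_cast <;> ring
      · refine (hA2 f M hf x s hs hsx).trans (mono (by linarith) (by positivity) (le_of_eq ?_)
          hA20.le)
        congr 2
        push_cast; ring
    · refine (hA j hkj f M hf x s hs hsx).trans (mono ?_ (by positivity) ?_ (hA0 j).le)
      · have := hSj j (by omega)
        have := hD0 j
        linarith
      · have := rpow_le_rpow_mul_rpow_of_le hs hsx' (p := 2 - α) (by linarith) (β - j) (α - 2)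
        calc bracket x ^ (β - j) = s ^ (α - 2 + (2 - α)) * bracket x ^ (β - j) := by simp
          _ ≤ _ := this
          _ = _ := by congr 2; ring
  · refine (hD j f M hcont hM hf.norm_le hf0 x s hs hsx).trans
      (mono ?_ (by positivity) le_rfl (hD0 j).le)
    have := hSj j (by omega)
    have := hA0 j
    linarith
  · rcases le_total s (bracket x / 4) with hsx | hsx
    · rw [add_comm k 3]
      exact (hA3 f M hf x s hs hsx).trans
        (mono (by linarith) (by positivity) (by norm_num) hA30.le)
    -- For `s ≥ bracket x / 4` the large-scale decay suffices: `β - k - α` is negative, so that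
    -- power of `s` is at most `W` times that of `bracket x`.
    · have h := hD (k + 3) f M hcont hM hf.norm_le hf0 x s hs (by linarith)
      have e : s ^ (β - (k + 3 : ℕ)) = s ^ (α - 3) * s ^ (β - k - α) := by
        rw [← Real.rpow_add hs]; push_cast; ring_nf
      have e2 : s ^ (β - k - α) ≤ W * bracket x ^ (β - k - α) := by
        have h3 : (16 * s) ^ (β - k - α) ≤ bracket x ^ (β - k - α) :=
          Real.rpow_le_rpow_of_nonpos hb (by linarith) hkα.le
        rw [Real.mul_rpow (by norm_num) hs.le] at h3
        rw [hW, Real.rpow_neg (by norm_num), ← div_eq_inv_mul, le_div_iff₀ (by positivity),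
          mul_comm]
        exact h3
      have h4 : D (k + 3) ≤ S := by
        have := hSj (k + 3) (by omega)
        have := hA0 (k + 3)
        linarith
      calc _ ≤ D (k + 3) * M * s ^ (β - (k + 3 : ℕ)) := h
        _ ≤ S * M * (s ^ (α - 3) * (W * bracket x ^ (β - k - α))) := by
            rw [e]
            gcongr
        _ = (S * W) * M * (s ^ (α - 3) * bracket x ^ (β - k - α)) := by ring
        _ ≤ _ := mono (by linarith) (by positivity) le_rfl hSW.le

end ScaleBounds

/-! ### The potential as an integral over scales, and its weighted Hölder bounds. -/

section Potential

theorem integrableOn_Ioc_rpow {p : ℝ} (hp : -1 < p) {a : ℝ} (ha : 0 < a) :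
    IntegrableOn (fun s : ℝ => s ^ p) (Set.Ioc 0 a) ∧
      ∫ s in Set.Ioc 0 a, s ^ p = a ^ (p + 1) / (p + 1) := by
  constructor
  · rw [← intervalIntegrable_iff_integrableOn_Ioc_of_le ha.le]
    exact intervalIntegral.intervalIntegrable_rpow' hp
  · rw [← intervalIntegral.integral_of_le ha.le, integral_rpow (Or.inl hp),
      Real.zero_rpow (by linarith), sub_zero]

/-- Integrability on the half line from power bounds near zero and near infinity. -/
theorem integrableOn_Ioi_of_rpow_bounds {V : Type*} [NormedAddCommGroup V] [NormedSpace ℝ V]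
    {G : ℝ → V} (hG : AEStronglyMeasurable G (volume.restrict (Set.Ioi 0))) {p q a A B : ℝ}
    (ha : 0 < a) (hp : -1 < p) (hq : q < -1)
    (h1 : ∀ s, 0 < s → s ≤ a → ‖G s‖ ≤ A * s ^ p) (h2 : ∀ s, a < s → ‖G s‖ ≤ B * s ^ q) :
    IntegrableOn G (Set.Ioi 0) ∧
      ‖∫ s in Set.Ioi 0, G s‖ ≤ A * (a ^ (p + 1) / (p + 1)) + B * (-a ^ (q + 1) / (q + 1)) := by
  have hU : Set.Ioc 0 a ∪ Set.Ioi a = Set.Ioi 0 := Set.Ioc_union_Ioi_eq_Ioi ha.le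
  have i1 : IntegrableOn G (Set.Ioc 0 a) :=
    ((integrableOn_Ioc_rpow hp ha).1.const_mul A).mono'
      (hG.mono_set (by rw [← hU]; exact Set.subset_union_left))
      (ae_restrict_of_forall_mem measurableSet_Ioc fun s hs => h1 s hs.1 hs.2)
  have i2 : IntegrableOn G (Set.Ioi a) :=
    ((integrableOn_Ioi_rpow_of_lt hq ha).const_mul B).mono'
      (hG.mono_set (by rw [← hU]; exact Set.subset_union_right))
      (ae_restrict_of_forall_mem measurableSet_Ioi fun s hs => h2 s hs)
  refine ⟨hU ▸ i1.union i2, ?_⟩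
  have hd : Disjoint (Set.Ioc 0 a) (Set.Ioi a) := Set.Ioc_disjoint_Ioi le_rfl
  rw [← hU, setIntegral_union hd measurableSet_Ioi i1 i2]
  refine (norm_add_le _ _).trans (add_le_add ?_ ?_)
  · rw [← (integrableOn_Ioc_rpow hp ha).2, ← integral_const_mul]
    exact norm_integral_le_of_norm_le ((integrableOn_Ioc_rpow hp ha).1.const_mul A)
      (ae_restrict_of_forall_mem measurableSet_Ioc fun s hs => h1 s hs.1 hs.2)
  · rw [← integral_Ioi_rpow_of_lt hq ha, ← integral_const_mul]
    exact norm_integral_le_of_norm_le ((integrableOn_Ioi_rpow_of_lt hq ha).const_mul B)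
      (ae_restrict_of_forall_mem measurableSet_Ioi fun s hs => h2 s hs)

variable {n : ℕ} {k : ℕ} {α β : ℝ} {φ : E n → ℝ}

/-- The superposition over all scales of the mollifications of `f`. -/
noncomputable def potential (φ f : E n → ℝ) (x : E n) : ℝ :=
  ∫ s in Set.Ioi (0 : ℝ), s • mollify (dilate φ s) f x

theorem iteratedFDeriv_smul_mollify (hφ : IsBump φ 1) {f : E n → ℝ} (hf : Continuous f) {s : ℝ}
    (hs : 0 < s) (j : ℕ) (x : E n) :
    iteratedFDeriv ℝ j (fun x => s • mollify (dilate φ s) f x) x =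
      s • iteratedFDeriv ℝ j (mollify (dilate φ s) f) x :=
  iteratedFDeriv_const_smul_apply' (mollify_contDiff (hφ.dilate hs) hf j).1.contDiffAt

theorem aestronglyMeasurable_iteratedFDeriv_mollify (hφ : IsBump φ 1) {f : E n → ℝ}
    (hf : Continuous f) (j : ℕ) (x : E n) :
    AEStronglyMeasurable (fun s : ℝ => s • iteratedFDeriv ℝ j (mollify (dilate φ s) f) x)
      (volume.restrict (Set.Ioi 0)) := by
  have hφj := hφ.continuous_iteratedFDeriv j
  have hm : StronglyMeasurable (Function.uncurry fun (s : ℝ) (y : E n) =>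
      f y • ((s ^ n)⁻¹ * (s⁻¹) ^ j) • iteratedFDeriv ℝ j φ (s⁻¹ • (x - y))) := by
    have hc : StronglyMeasurable fun p : ℝ × E n => (p.1 ^ n)⁻¹ * (p.1⁻¹) ^ j :=
      Measurable.stronglyMeasurable (by fun_prop)
    have hd : StronglyMeasurable fun p : ℝ × E n =>
        iteratedFDeriv ℝ j φ (p.1⁻¹ • (x - p.2)) :=
      hφj.comp_stronglyMeasurable (Measurable.stronglyMeasurable (by fun_prop))
    exact (hf.comp continuous_snd).stronglyMeasurable.smul (hc.smul hd)
  have h2 : StronglyMeasurable fun s : ℝ => s • ∫ y,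
      f y • ((s ^ n)⁻¹ * (s⁻¹) ^ j) • iteratedFDeriv ℝ j φ (s⁻¹ • (x - y)) :=
    stronglyMeasurable_id.smul hm.integral_prod_right
  refine h2.aestronglyMeasurable.congr ?_
  refine ae_restrict_of_forall_mem measurableSet_Ioi fun s (hs : 0 < s) => ?_
  change s • _ = s • _
  congr 1
  rw [((mollify_contDiff (hφ.dilate hs) hf j).2 j le_rfl x).2]
  refine integral_congr_ae (Filter.Eventually.of_forall fun y => ?_)
  simp only [iteratedFDeriv_dilate hφ]
  ext v
  simp
  ring

/-- The integrand is `O(s ^ (α - 1))` at small scales and `O(s ^ (β + 1 - j))` at large ones;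
splitting the integral at `bracket x / 8` gives `bracket x ^ (β + 2 - j)` from both ends. -/
theorem exists_potential_holderBound (hn : 2 ≤ n) (hα : α ∈ Set.Ioo (0 : ℝ) 1) (hφ : IsBump φ 1)
    (h1 : -1 - (n : ℝ) < β) (h0 : β < -2) (hne : β ≠ -(n : ℝ)) :
    ∃ C, 0 < C ∧ ∀ (f : E n → ℝ) (M : ℝ), HolderBound k α β M f →
      (β < -(n : ℝ) → ∫ y, f y = 0) →
      HolderBound (k + 2) α (β + 2) (C * M) (potential φ f) ∧ ∀ j ≤ k + 2, ∀ x,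
        IntegrableOn (fun s : ℝ => s • iteratedFDeriv ℝ j (mollify (dilate φ s) f) x)
          (Set.Ioi 0) ∧
        iteratedFDeriv ℝ j (potential φ f) x =
          ∫ s in Set.Ioi (0 : ℝ), s • iteratedFDeriv ℝ j (mollify (dilate φ s) f) x := by
  obtain ⟨C, hC0, hC⟩ := exists_scale_bounds (k := k) hn hα hφ h1 h0 hne
  obtain ⟨hα0, hα1⟩ := hα
  set A : ℝ := 8 ^ ((k : ℝ) - β) / α + 8 ^ ((k : ℝ) - β) / (-β - 2) with hA
  -- The two terms of `A` come from scales below and above `bracket x / 8`.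
  have hA0 : 0 < A := by
    have : 0 < -β - 2 := by linarith
    positivity
  set W : ℝ := 2 ^ |β - k - α| with hW
  have hW0 : 0 < W := by positivity
  set H : ℝ := (1 + W) / α + 2 * W / (1 - α) with hH
  have hH0 : 0 < H := by
    have : 0 < 1 - α := by linarith
    positivity
  refine ⟨C * (A + H), by positivity, fun f M hf hf0 => ?_⟩
  have hM := hf.nonneg
  have hcont := hf.contDiff.continuous
  have hS := hC f M hf hf0
  have hsm : ∀ {a b : ℝ}, 0 < a → a * a ^ b = a ^ (b + 1) := fun ha => by
    rw [Real.rpow_add_one ha.ne', mul_comm]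
  have b1 : ∀ j ≤ k + 2, ∀ (x : E n) (s : ℝ), 0 < s → s ≤ bracket x / 4 →
      ‖s • iteratedFDeriv ℝ j (mollify (dilate φ s) f) x‖ ≤
        C * M * bracket x ^ (β + 2 - j - α) * s ^ (α - 1) := by
    intro j hj x s hs hsx
    rw [norm_smul, Real.norm_of_nonneg hs.le]
    calc _ ≤ s * (C * M * (s ^ (α - 2) * bracket x ^ (β + 2 - j - α))) := by
          gcongr
          exact (hS x s hs).1 j hj hsx
      _ = C * M * bracket x ^ (β + 2 - j - α) * (s * s ^ (α - 2)) := by ring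
      _ = _ := by rw [hsm hs]; ring_nf
  have b2 : ∀ j ≤ k + 2, ∀ (x : E n) (s : ℝ), 0 < s → bracket x ≤ 16 * s →
      ‖s • iteratedFDeriv ℝ j (mollify (dilate φ s) f) x‖ ≤ C * M * s ^ (β + 1 - j) := by
    intro j hj x s hs hsx
    rw [norm_smul, Real.norm_of_nonneg hs.le]
    calc _ ≤ s * (C * M * s ^ (β - j)) := by
          gcongr
          exact (hS x s hs).2.1 j hj hsx
      _ = C * M * (s * s ^ (β - j)) := by ring
      _ = _ := by rw [hsm hs]; ring_nf
  have hmeas := aestronglyMeasurable_iteratedFDeriv_mollify (f := f) hφ hcont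
  have hqj : ∀ j : ℕ, β + 1 - j < -1 := fun j => by
    have : (0 : ℝ) ≤ j := Nat.cast_nonneg j
    linarith
  have hpar := contDiff_integral_of_dominated (μ := volume.restrict (Set.Ioi (0 : ℝ))) (k + 2)
    (Φ := fun s x => s • mollify (dilate φ s) f x) ?_ ?_ ?_
  rotate_left
  · refine ae_restrict_of_forall_mem measurableSet_Ioi fun s (hs : 0 < s) => ?_
    exact (mollify_contDiff (hφ.dilate hs) hcont (k + 2)).1.const_smul s
  · intro j hj x
    refine (hmeas j x).congr ?_
    refine ae_restrict_of_forall_mem measurableSet_Ioi fun s (hs : 0 < s) => ?_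
    exact (iteratedFDeriv_smul_mollify hφ hcont hs j x).symm
  · intro j hj x₀
    have hb := bracket_pos x₀
    set A₁ := C * M * (2 ^ |β + 2 - j - α| * bracket x₀ ^ (β + 2 - j - α)) with hA₁
    have hA₁0 : 0 ≤ A₁ := by positivity
    -- On this ball `bracket x` lies between `3/4` and `2` times `bracket x₀`. Hence `s ≤ bracket x₀
    -- / 8` gives `s ≤ bracket x / 4`, and `s > bracket x₀ / 8` gives `bracket x ≤ 16 * s`: one
    -- threshold serves every `x` in the ball.
    refine ⟨bracket x₀ / 4, by positivity,
      fun s => if s ≤ bracket x₀ / 8 then A₁ * s ^ (α - 1) else C * M * s ^ (β + 1 - j), ?_, ?_⟩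
    · refine (integrableOn_Ioi_of_rpow_bounds (A := A₁) (B := C * M) (a := bracket x₀ / 8)
        (p := α - 1) (q := β + 1 - j) ?_ (by positivity) (by linarith) (hqj j) ?_ ?_).1
      · exact (Measurable.ite measurableSet_Iic (by fun_prop) (by fun_prop)).aestronglyMeasurable
      · intro s hs hsa
        rw [if_pos hsa, Real.norm_of_nonneg (by positivity)]
      · intro s hsa
        have hs : 0 < s := by linarith
        rw [if_neg (not_le.2 hsa), Real.norm_of_nonneg (by positivity)]
    · refine ae_restrict_of_forall_mem measurableSet_Ioi fun s (hs : 0 < s) x hx => ?_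
      rw [Metric.mem_ball, dist_comm, dist_eq_norm] at hx
      obtain ⟨hx1, hx2⟩ := bracket_le_of_near hx.le
      rw [iteratedFDeriv_smul_mollify hφ hcont hs]
      dsimp only
      split_ifs with hsa
      · refine (b1 j hj x s hs (by linarith)).trans ?_
        rw [hA₁]
        have := bracket_rpow_le_of_near hx.le (β + 2 - j - α)
        gcongr
      · exact b2 j hj x s hs (by linarith)
  have hrepr : ∀ j ≤ k + 2, ∀ x,
        IntegrableOn (fun s : ℝ => s • iteratedFDeriv ℝ j (mollify (dilate φ s) f) x)
          (Set.Ioi 0) ∧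
        iteratedFDeriv ℝ j (potential φ f) x =
          ∫ s in Set.Ioi (0 : ℝ), s • iteratedFDeriv ℝ j (mollify (dilate φ s) f) x := by
    intro j hj x
    have hcongr : ∀ᵐ s : ℝ ∂(volume.restrict (Set.Ioi 0)),
        iteratedFDeriv ℝ j (fun x => s • mollify (dilate φ s) f x) x =
          s • iteratedFDeriv ℝ j (mollify (dilate φ s) f) x :=
      ae_restrict_of_forall_mem measurableSet_Ioi fun s (hs : 0 < s) =>
        iteratedFDeriv_smul_mollify hφ hcont hs j x
    obtain ⟨hi, he⟩ := hpar.2 j hj x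
    exact ⟨hi.congr hcongr, he.trans (integral_congr_ae hcongr)⟩
  refine ⟨⟨hpar.1, fun j hj x => ?_, fun x y hxy => ?_⟩, hrepr⟩
  · rw [(hrepr j hj x).2]
    have hb := bracket_pos x
    have hj' : (j : ℝ) ≤ k + 2 := by exact_mod_cast hj
    have hj0 : (0 : ℝ) ≤ j := Nat.cast_nonneg j
    refine (integrableOn_Ioi_of_rpow_bounds (A := C * M * bracket x ^ (β + 2 - j - α))
      (B := C * M) (a := bracket x / 8) (p := α - 1) (q := β + 1 - j) (hmeas j x)
      (by positivity) (by linarith) (hqj j) ?_ ?_).2.trans ?_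
    · exact fun s hs hsa => b1 j hj x s hs (by linarith)
    · exact fun s hsa => b2 j hj x s (by linarith) (by linarith)
    · have h8 : (0 : ℝ) < 8 := by norm_num
      have e1 : bracket x ^ (β + 2 - j - α) * ((bracket x / 8) ^ (α - 1 + 1) / (α - 1 + 1)) ≤
          8 ^ ((k : ℝ) - β) / α * bracket x ^ (β + 2 - j) := by
        rw [sub_add_cancel, Real.div_rpow hb.le h8.le, div_div, mul_div_assoc', ← Real.rpow_add hb,
          sub_add_cancel, div_eq_mul_inv, mul_comm]
        gcongr
        rw [mul_inv, div_eq_mul_inv, ← Real.rpow_neg h8.le]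
        gcongr
        · norm_num
        · have : (0 : ℝ) ≤ k := Nat.cast_nonneg k
          linarith
      have e2 : -(bracket x / 8) ^ (β + 1 - j + 1) / (β + 1 - j + 1) ≤
          8 ^ ((k : ℝ) - β) / (-β - 2) * bracket x ^ (β + 2 - j) := by
        have h9 : (8 : ℝ) ^ ((j : ℝ) - β - 2) ≤ 8 ^ ((k : ℝ) - β) :=
          Real.rpow_le_rpow_of_exponent_le (by norm_num) (by linarith)
        rw [show β + 1 - j + 1 = -(j - β - 2) by ring, neg_div_neg_eq,
          Real.div_rpow hb.le h8.le, Real.rpow_neg h8.le, div_inv_eq_mul,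
          show -((j : ℝ) - β - 2) = β + 2 - j by ring, mul_div_assoc, mul_comm]
        exact mul_le_mul_of_nonneg_right
          (div_le_div₀ (by positivity) h9 (by linarith) (by linarith)) (by positivity)
      have hCM : 0 ≤ C * M := by positivity
      have hX : 0 ≤ C * M * H * bracket x ^ (β + 2 - j) := by positivity
      calc _ = C * M * (bracket x ^ (β + 2 - j - α) *
              ((bracket x / 8) ^ (α - 1 + 1) / (α - 1 + 1))) +
              C * M * (-(bracket x / 8) ^ (β + 1 - j + 1) / (β + 1 - j + 1)) := by ring
        _ ≤ C * M * (8 ^ ((k : ℝ) - β) / α * bracket x ^ (β + 2 - j)) +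
              C * M * (8 ^ ((k : ℝ) - β) / (-β - 2) * bracket x ^ (β + 2 - j)) := by gcongr
        _ = C * M * A * bracket x ^ (β + 2 - j) := by rw [hA]; ring
        _ ≤ _ := by linarith
  · have hb := bracket_pos x
    rcases eq_or_ne x y with rfl | hne
    · rw [sub_self, norm_zero]
      positivity
    have hδ : 0 < ‖x - y‖ := norm_pos_iff.2 (sub_ne_zero.2 hne)
    set δ := ‖x - y‖ with hδdef
    have hexp : β + 2 - (k + 2 : ℕ) - α = β - k - α := by push_cast; ring
    have hby : bracket y ^ (β - k - α) ≤ W * bracket x ^ (β - k - α) :=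
      bracket_rpow_le_of_near hxy _
    obtain ⟨hy1, hy2⟩ := bracket_le_of_near hxy
    rw [(hrepr _ le_rfl x).2, (hrepr _ le_rfl y).2,
      ← integral_sub (hrepr _ le_rfl x).1 (hrepr _ le_rfl y).1, hexp]
    -- The split is at half the distance of the points: below it the two terms are bounded
    -- separately, above it the mean value theorem is applied with the bound of order `k + 3`. Both
    -- parts integrate to a multiple of `δ ^ α`, using `α > 0` and `α < 1` respectively.
    refine (integrableOn_Ioi_of_rpow_bounds (A := C * M * (1 + W) * bracket x ^ (β - k - α))
      (B := C * M * W * bracket x ^ (β - k - α) * δ) (a := δ / 2) (p := α - 1) (q := α - 2)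
      ((hmeas _ x).sub (hmeas _ y))
      (by positivity) (by linarith) (by linarith) ?_ ?_).2.trans ?_
    · intro s hs hsδ
      have h3 := b1 _ le_rfl x s hs (by linarith)
      have h4 := b1 _ le_rfl y s hs (by linarith)
      rw [hexp] at h3 h4
      refine (norm_sub_le _ _).trans ((add_le_add h3 h4).trans ?_)
      calc _ ≤ C * M * bracket x ^ (β - k - α) * s ^ (α - 1) +
            C * M * (W * bracket x ^ (β - k - α)) * s ^ (α - 1) := by gcongr
        _ = _ := by ring
    · intro s hsδ
      have hs : 0 < s := by linarith
      have hGs := mollify_contDiff (hφ.dilate hs) hcont (k + 3)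
      have hmv := Convex.norm_image_sub_le_of_norm_fderiv_le (𝕜 := ℝ)
        (f := iteratedFDeriv ℝ (k + 2) (mollify (dilate φ s) f))
        (s := Metric.closedBall x (bracket x / 4))
        (C := C * M * (s ^ (α - 3) * (W * bracket x ^ (β - k - α)))) (x := y) (y := x)
        (fun z _ => hGs.1.differentiable_iteratedFDeriv
          (by exact_mod_cast Nat.lt_succ_self (k + 2)) z)
        (fun z hz => by
          rw [norm_fderiv_iteratedFDeriv]
          rw [Metric.mem_closedBall, dist_comm, dist_eq_norm] at hz
          refine ((hS z s hs).2.2).trans ?_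
          have := bracket_rpow_le_of_near hz (β - k - α)
          gcongr)
        (convex_closedBall _ _)
        (by rw [Metric.mem_closedBall, dist_comm, dist_eq_norm]; exact hxy)
        (Metric.mem_closedBall_self (by positivity))
      rw [Pi.sub_apply, ← smul_sub, norm_smul, Real.norm_of_nonneg hs.le]
      calc _ ≤ s * (C * M * (s ^ (α - 3) * (W * bracket x ^ (β - k - α))) * δ) := by gcongr
        _ = C * M * W * bracket x ^ (β - k - α) * δ * (s * s ^ (α - 3)) := by ring
        _ = _ := by rw [hsm hs]; ring_nf
    · have hCM : 0 ≤ C * M := by positivity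
      have hα' : 0 < 1 - α := by linarith
      have e1 : (δ / 2) ^ (α - 1 + 1) / (α - 1 + 1) ≤ 1 / α * δ ^ α := by
        rw [sub_add_cancel, div_mul_eq_mul_div, one_mul]
        gcongr
        linarith
      have e2 : δ * (-(δ / 2) ^ (α - 2 + 1) / (α - 2 + 1)) ≤ 2 / (1 - α) * δ ^ α := by
        rw [show α - 2 + 1 = -(1 - α) by ring, neg_div_neg_eq]
        have e3 : (δ / 2) ^ (-(1 - α)) ≤ 2 * (δ ^ α / δ) := by
          rw [Real.div_rpow hδ.le two_pos.le, Real.rpow_neg two_pos.le, div_inv_eq_mul, neg_sub,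
            Real.rpow_sub_one hδ.ne', mul_comm]
          gcongr
          calc (2 : ℝ) ^ (1 - α) ≤ 2 ^ (1 : ℝ) := by
                apply Real.rpow_le_rpow_of_exponent_le <;> linarith
            _ = 2 := Real.rpow_one 2
        calc _ ≤ δ * (2 * (δ ^ α / δ) / (1 - α)) := by gcongr
          _ = _ := by field_simp
      have hX : 0 ≤ C * M * A * bracket x ^ (β - k - α) * δ ^ α := by positivity
      calc _ = C * M * (1 + W) * bracket x ^ (β - k - α) *
              ((δ / 2) ^ (α - 1 + 1) / (α - 1 + 1)) + C * M * W * bracket x ^ (β - k - α) *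
              (δ * (-(δ / 2) ^ (α - 2 + 1) / (α - 2 + 1))) := by ring
        _ ≤ C * M * (1 + W) * bracket x ^ (β - k - α) * (1 / α * δ ^ α) +
              C * M * W * bracket x ^ (β - k - α) * (2 / (1 - α) * δ ^ α) := by gcongr
        _ = C * M * H * bracket x ^ (β - k - α) * δ ^ α := by rw [hH]; ring
        _ ≤ _ := by linarith

end Potential

/-! ### The kernel identity and the equation for the potential. -/

section Laplacian

variable {n : ℕ}

/-- The trace of a bilinear form in the standard basis. -/
noncomputable def traceCLM (n : ℕ) : (E n [×2]→L[ℝ] ℝ) →L[ℝ] ℝ :=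
  ∑ i : Fin n, ContinuousMultilinearMap.apply ℝ (fun _ : Fin 2 => E n) ℝ
    ![EuclideanSpace.single i 1, EuclideanSpace.single i 1]

theorem traceCLM_apply (T : E n [×2]→L[ℝ] ℝ) : traceCLM n T =
    ∑ i : Fin n, T ![EuclideanSpace.single i 1, EuclideanSpace.single i 1] := by
  simp [traceCLM]

theorem geomLaplacian_eq (u : E n → ℝ) (x : E n) :
    geomLaplacian u x = -traceCLM n (iteratedFDeriv ℝ 2 u x) := by
  rw [geomLaplacian, InnerProductSpace.laplacian_eq_iteratedFDeriv_orthonormalBasis u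
    (EuclideanSpace.basisFun (Fin n) ℝ), traceCLM_apply]
  simp

/-- A pair of bumps such that the Laplacian of `φ` is minus the divergence of `x η`. -/
structure IsKernelPair (φ η : E n → ℝ) : Prop where
  left : IsBump φ 1
  right : IsBump η 1
  integral_eq : ∫ z, η z = 1
  trace_eq : ∀ z, traceCLM n (iteratedFDeriv ℝ 2 φ z) = -(n * η z + fderiv ℝ η z z)

theorem contDiff_deriv_smoothTransition : ContDiff ℝ ∞ (deriv Real.smoothTransition) :=
  (contDiff_infty_iff_deriv.1 Real.smoothTransition.contDiff).2

theorem deriv_smoothTransition_of_neg {t : ℝ} (ht : t < 0) : deriv Real.smoothTransition t = 0 := by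
  have : Real.smoothTransition =ᶠ[nhds t] fun _ => 0 := by
    filter_upwards [Iio_mem_nhds ht] with r hr
    exact Real.smoothTransition.zero_of_nonpos (le_of_lt hr)
  rw [this.deriv_eq, deriv_const]

theorem exists_deriv_smoothTransition_ne_zero :
    ∃ t ∈ Set.Ioo (0 : ℝ) 1, deriv Real.smoothTransition t ≠ 0 := by
  obtain ⟨t, ht, he⟩ := exists_deriv_eq_slope Real.smoothTransition zero_lt_one
    Real.smoothTransition.continuous.continuousOn
    ((Real.smoothTransition.contDiff (n := 1)).differentiable one_ne_zero).differentiableOn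
  exact ⟨t, ht, by rw [he]; simp⟩

/-- For `φ₀ = χ(1 - |z|²)` with `χ` the smooth transition, the gradient is `-η₀ z` with `η₀ = 2 χ'(1
- |z|²)`. Taking the divergence gives the trace identity, and dividing both by `∫ η₀` normalises. -/
theorem exists_isKernelPair (hn : 1 ≤ n) : ∃ φ η : E n → ℝ, IsKernelPair φ η := by
  have hq : ContDiff ℝ ∞ fun z : E n => 1 - ‖z‖ ^ 2 := contDiff_const.sub (contDiff_norm_sq ℝ)
  have hqd : ∀ z : E n, HasFDerivAt (fun z : E n => 1 - ‖z‖ ^ 2) (-(2 • innerSL ℝ z)) z :=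
    fun z => (hasStrictFDerivAt_norm_sq z).hasFDerivAt.const_sub 1
  set η₀ : E n → ℝ := fun z => 2 * deriv Real.smoothTransition (1 - ‖z‖ ^ 2) with hη₀
  have hη₀c : ContDiff ℝ ∞ η₀ := contDiff_const.mul (contDiff_deriv_smoothTransition.comp hq)
  have hneg : ∀ z : E n, 1 < ‖z‖ → 1 - ‖z‖ ^ 2 < 0 := fun z hz => by nlinarith
  have hη₀b : IsBump η₀ 1 := ⟨hη₀c, fun z hz => by
    simp [hη₀, deriv_smoothTransition_of_neg (hneg z hz)]⟩
  set φ₀ : E n → ℝ := fun z => Real.smoothTransition (1 - ‖z‖ ^ 2) with hφ₀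
  have hφ₀b : IsBump φ₀ 1 := ⟨Real.smoothTransition.contDiff.comp hq, fun z hz =>
    Real.smoothTransition.zero_of_nonpos (hneg z hz).le⟩
  have hpos : 0 < ∫ z, η₀ z := by
    -- Monotonicity of the transition makes `η₀ ≥ 0`; it is nonzero at a point with `‖z‖² = 1 - t`.
    obtain ⟨t, ht, hne⟩ := exists_deriv_smoothTransition_ne_zero
    refine hη₀c.continuous.integral_pos_of_hasCompactSupport_nonneg_nonzero
      hη₀b.hasCompactSupport (fun z => mul_nonneg two_pos.le Real.smoothTransition.monotone.deriv_nonneg)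
      (x := EuclideanSpace.single (⟨0, hn⟩ : Fin n) (√(1 - t))) ?_
    have hs : (√(1 - t)) ^ 2 = 1 - t := Real.sq_sqrt (by linarith [ht.2])
    simp [hη₀, hs, hne]
  set c := (∫ z, η₀ z)⁻¹ with hc
  let L : E n →L[ℝ] E n →L[ℝ] ℝ := (isBoundedBilinearMap_inner (𝕜 := ℝ)).toContinuousLinearMap
  have hL : ∀ z v, L z v = inner ℝ z v := fun _ _ => rfl
  have hφd : ∀ z, HasFDerivAt (fun z => c * φ₀ z) (-(c * η₀ z) • L z) z := by
    intro z
    have h1 := ((Real.smoothTransition.contDiff (n := 1)).differentiable one_ne_zero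
      (1 - ‖z‖ ^ 2)).hasDerivAt.comp_hasFDerivAt z (hqd z)
    have h2 := h1.const_mul c
    refine h2.congr_fderiv ?_
    ext v
    simp [hη₀, hL]
    ring
  have hηc : ContDiff ℝ ∞ fun z => c * η₀ z := contDiff_const.mul hη₀c
  refine ⟨fun z => c * φ₀ z, fun z => c * η₀ z,
    ⟨contDiff_const.mul hφ₀b.contDiff, fun z hz => by simp [hφ₀b.eq_zero z hz]⟩,
    ⟨hηc, fun z hz => by simp [hη₀b.eq_zero z hz]⟩, ?_, fun z => ?_⟩
  · rw [integral_const_mul, hc, inv_mul_cancel₀ hpos.ne']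
  · have hηd : HasFDerivAt (fun z => c * η₀ z) (fderiv ℝ (fun z => c * η₀ z) z) z :=
      (hηc.differentiable (by simp) z).hasFDerivAt
    have hf : fderiv ℝ (fun z => c * φ₀ z) = fun z => -(c * η₀ z) • L z :=
      funext fun z => (hφd z).fderiv
    have h2 : HasFDerivAt (fun z => -(c * η₀ z) • L z)
        (-(c * η₀ z) • L + (-(fderiv ℝ (fun z => c * η₀ z) z)).smulRight (L z)) z :=
      hηd.neg.smul L.hasFDerivAt
    rw [traceCLM_apply]
    simp only [iteratedFDeriv_two_apply, hf, h2.fderiv]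
    have hDz : fderiv ℝ (fun z => c * η₀ z) z z =
        ∑ i : Fin n, z i * fderiv ℝ (fun z => c * η₀ z) z (EuclideanSpace.single i (1 : ℝ)) := by
      have hz := (EuclideanSpace.basisFun (Fin n) ℝ).sum_repr z
      have := congrArg (fderiv ℝ (fun z => c * η₀ z) z) hz
      rw [map_sum] at this
      simpa using this.symm
    rw [hDz]
    simp [hL, Finset.sum_add_distrib,
      EuclideanSpace.inner_single_right, mul_comm]
    ring

variable {φ η : E n → ℝ}

/-- Differentiating `s⁻ⁿ η(w/s)` in `s` produces `-s⁻ⁿ⁻¹ (n η + z·∇η)` at `z = w/s`, which is the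
scaled trace of `D²φ`. -/
theorem hasDerivAt_dilate (h : IsKernelPair φ η) {s : ℝ} (hs : s ≠ 0) (w : E n) :
    HasDerivAt (fun s => dilate η s w)
      (s * traceCLM n (iteratedFDeriv ℝ 2 (dilate φ s) w)) s := by
  rw [iteratedFDeriv_dilate h.left, map_smul, h.trace_eq, smul_eq_mul]
  have h1 : HasDerivAt (fun s : ℝ => (s ^ n)⁻¹) (-(n * s ^ (n - 1)) / (s ^ n) ^ 2) s :=
    (hasDerivAt_pow n s).inv (pow_ne_zero n hs)
  have h2 : HasDerivAt (fun s : ℝ => s⁻¹ • w) (-(s ^ 2)⁻¹ • w) s :=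
    (hasDerivAt_inv hs).smul_const w
  have h3 : HasFDerivAt η (fderiv ℝ η (s⁻¹ • w)) (s⁻¹ • w) :=
    (h.right.contDiff.differentiable (by simp) _).hasFDerivAt
  have h4 := h1.mul (h3.comp_hasDerivAt s h2)
  refine h4.congr_deriv ?_
  simp only [map_smul, smul_eq_mul, Function.comp]
  rcases n with _ | m
  · simp
    field_simp
  · rw [Nat.add_sub_cancel]
    field_simp
    ring

/-- Averages of `f` around `x` at scale `s`, including `s = 0`. -/
noncomputable def scaleAverage (η f : E n → ℝ) (x : E n) (s : ℝ) : ℝ :=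
  ∫ z, η z * f (x - s • z)

theorem mollify_dilate_eq_scaleAverage (η f : E n → ℝ) (x : E n) {s : ℝ} (hs : 0 < s) :
    mollify (dilate η s) f x = scaleAverage η f x s := by
  have h := Measure.integral_comp_inv_smul_of_nonneg (volume : Measure (E n))
    (fun z => η z * f (x - s • z)) hs.le
  rw [finrank_euclideanSpace_fin] at h
  rw [mollify_eq, scaleAverage, ← inv_smul_eq_iff₀ (by positivity : s ^ n ≠ 0)] at *
  rw [← h, smul_eq_mul, ← integral_const_mul]
  refine integral_congr_ae (Filter.Eventually.of_forall fun z => ?_)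
  simp only [dilate, smul_eq_mul, smul_inv_smul₀ hs.ne']
  ring

/-- Continuity at `s = 0` is what the fundamental theorem of calculus needs at its lower endpoint,
where the average equals `f x` once `∫ η = 1`. -/
theorem continuous_scaleAverage (hη : IsBump η 1) {f : E n → ℝ} (hf : Continuous f) (x : E n) :
    Continuous (scaleAverage η f x) := by
  have hcη := hη.contDiff.continuous
  refine continuous_iff_continuousAt.2 fun s₀ => ?_
  obtain ⟨B, hB⟩ := (isCompact_closedBall x (|s₀| + 1)).exists_bound_of_continuousOn hf.continuousOn
  refine continuousAt_of_dominated (bound := fun z => ‖η z‖ * B)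
    (Filter.Eventually.of_forall fun s => Continuous.aestronglyMeasurable (by fun_prop)) ?_
    ((hcη.integrable_of_hasCompactSupport hη.hasCompactSupport).norm.mul_const B)
    (Filter.Eventually.of_forall fun z => by fun_prop)
  filter_upwards [Metric.ball_mem_nhds s₀ one_pos] with s hs
  refine Filter.Eventually.of_forall fun z => ?_
  rw [norm_mul]
  by_cases hz : 1 < ‖z‖
  · simp [hη.eq_zero z hz]
  · refine mul_le_mul_of_nonneg_left (hB _ ?_) (norm_nonneg _)
    rw [Metric.mem_closedBall, dist_eq_norm, sub_sub_cancel_left, norm_neg, norm_smul]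
    rw [Metric.mem_ball, Real.dist_eq] at hs
    have h1 : |s| ≤ |s₀| + 1 := by
      have := abs_sub_abs_le_abs_sub s s₀
      linarith
    calc ‖s‖ * ‖z‖ ≤ (|s₀| + 1) * 1 := by
          refine mul_le_mul h1 (not_lt.1 hz) (norm_nonneg _) (by positivity)
      _ = _ := mul_one _

theorem hasDerivAt_scaleAverage (h : IsKernelPair φ η) {f : E n → ℝ} (hf : Continuous f) (x : E n)
    {s : ℝ} (hs : 0 < s) : HasDerivAt (scaleAverage η f x)
      (traceCLM n (s • iteratedFDeriv ℝ 2 (mollify (dilate φ s) f) x)) s := by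
  obtain ⟨B, hB0, hB⟩ := h.left.exists_bound 2
  have hb : Metric.ball s (s / 2) ∈ nhds s := Metric.ball_mem_nhds _ (by positivity)
  have hball : ∀ r ∈ Metric.ball s (s / 2), s / 2 < r ∧ r < 2 * s := fun r hr => by
    rw [Metric.mem_ball, Real.dist_eq, abs_lt] at hr
    constructor <;> linarith
  obtain ⟨hi, he⟩ := (mollify_contDiff (h.left.dilate hs) hf 2).2 2 le_rfl x
  have hval : traceCLM n (s • iteratedFDeriv ℝ 2 (mollify (dilate φ s) f) x) =
      ∫ y, (s * traceCLM n (iteratedFDeriv ℝ 2 (dilate φ s) (x - y))) * f y := by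
    rw [map_smul, he, ← ContinuousLinearMap.integral_comp_comm _ hi, smul_eq_mul,
      ← integral_const_mul]
    refine integral_congr_ae (Filter.Eventually.of_forall fun y => ?_)
    simp [traceCLM_apply, Finset.mul_sum, Finset.sum_mul, mul_assoc]
  rw [hval]
  have hcη : Continuous η := h.right.contDiff.continuous
  have key := (hasDerivAt_integral_of_dominated_loc_of_deriv_le
    (F := fun r y => dilate η r (x - y) * f y)
    (F' := fun r y => (r * traceCLM n (iteratedFDeriv ℝ 2 (dilate φ r) (x - y))) * f y)
    (μ := (volume : Measure (E n))) (x₀ := s)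
    (bound := (Metric.closedBall x (2 * s)).indicator fun y =>
      2 * s * (‖traceCLM n‖ * ((s / 2) ^ (-(n : ℝ) - (2 : ℕ)) * B)) * ‖f y‖) hb ?_ ?_ ?_ ?_ ?_ ?_).2
  · refine key.congr_of_eventuallyEq ?_
    filter_upwards [hb] with r hr
    rw [← mollify_dilate_eq_scaleAverage η f x (by linarith [(hball r hr).1])]
    rfl
  · refine Filter.Eventually.of_forall fun r => Continuous.aestronglyMeasurable ?_
    unfold dilate
    fun_prop
  · exact (mollify_contDiff (h.right.dilate hs) hf 0).2 0 le_rfl x |>.1.norm.mono'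
      (by unfold dilate; exact Continuous.aestronglyMeasurable (by fun_prop))
      (Filter.Eventually.of_forall fun y => by simp [ContinuousMultilinearMap.norm_smulRight])
  · have := (h.left.dilate hs).continuous_iteratedFDeriv 2
    exact Continuous.aestronglyMeasurable (by fun_prop)
  · refine Filter.Eventually.of_forall fun y r hr => ?_
    obtain ⟨hr1, hr2⟩ := hball r hr
    have hr0 : 0 < r := by linarith
    by_cases hy : y ∈ Metric.closedBall x (2 * s)
    · rw [Set.indicator_of_mem hy, norm_mul, norm_mul, Real.norm_of_nonneg hr0.le]
      have h1 := norm_iteratedFDeriv_dilate_le h.left hr0 hB (x - y)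
      have h2 : r ^ (-(n : ℝ) - (2 : ℕ)) ≤ (s / 2) ^ (-(n : ℝ) - (2 : ℕ)) :=
        Real.rpow_le_rpow_of_nonpos (by positivity) hr1.le
          (by have : (0 : ℝ) ≤ n := Nat.cast_nonneg n
              push_cast; linarith)
      have h3 := (traceCLM n).le_opNorm (iteratedFDeriv ℝ 2 (dilate φ r) (x - y))
      gcongr
      refine h3.trans ?_
      gcongr
      refine h1.trans ?_
      gcongr
    · rw [Set.indicator_of_notMem hy, (h.left.dilate hr0).iteratedFDeriv_eq_zero]
      · simp
      · rw [Metric.mem_closedBall, not_le, dist_comm, dist_eq_norm] at hy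
        linarith
  · rw [integrable_indicator_iff Metric.isClosed_closedBall.measurableSet]
    exact (continuous_const.mul hf.norm).continuousOn.integrableOn_compact
      (isCompact_closedBall _ _)
  · refine Filter.Eventually.of_forall fun y r hr => ?_
    exact (hasDerivAt_dilate h (by linarith [(hball r hr).1] : 0 < r).ne' (x - y)).mul_const _

theorem geomLaplacian_potential {k : ℕ} {α β : ℝ} (hn : 2 ≤ n) (hα : α ∈ Set.Ioo (0 : ℝ) 1)
    (h : IsKernelPair φ η) (h1 : -1 - (n : ℝ) < β) (h0 : β < -2) (hne : β ≠ -(n : ℝ))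
    {f : E n → ℝ} {M : ℝ} (hf : HolderBound k α β M f) (hf0 : β < -(n : ℝ) → ∫ y, f y = 0) :
    geomLaplacian (potential φ f) = f := by
  funext x
  obtain ⟨C, -, hC⟩ := exists_potential_holderBound (k := k) hn hα h.left h1 h0 hne
  obtain ⟨hi, he⟩ := (hC f M hf hf0).2 2 (by omega) x
  have hcont := hf.contDiff.continuous
  have htend : Filter.Tendsto (scaleAverage η f x) Filter.atTop (nhds 0) := by
    obtain ⟨D, -, hD⟩ := exists_far_bound hn h.right 0 h1 (by linarith) hne
    have hlim : Filter.Tendsto (fun s : ℝ => D * M * s ^ β) Filter.atTop (nhds 0) := by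
      have := (tendsto_rpow_neg_atTop (y := -β) (by linarith)).const_mul (D * M)
      simpa using this
    refine squeeze_zero_norm' ?_ hlim
    filter_upwards [Filter.eventually_ge_atTop (bracket x)] with s hs
    have hs0 := (bracket_pos x).trans_le hs
    have := hD f M hcont hf.nonneg hf.norm_le hf0 x s hs0 (by linarith)
    rw [← mollify_dilate_eq_scaleAverage η f x hs0]
    simpa using this
  -- The Laplacian integrand is the scale derivative of the average, so the integral telescopes
  -- between `f x` at `s = 0` and `0` at infinity.
  have hFTC := integral_Ioi_of_hasDerivAt_of_tendsto
    (continuous_scaleAverage h.right hcont x).continuousWithinAt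
    (fun s (hs : 0 < s) => hasDerivAt_scaleAverage h hcont x hs)
    ((traceCLM n).integrable_comp hi) htend
  rw [geomLaplacian_eq, he, ← ContinuousLinearMap.integral_comp_comm _ hi, hFTC, zero_sub, neg_neg,
    scaleAverage]
  simp [integral_mul_const, h.integral_eq]

end Laplacian

/-! ### Comparison of the weighted Hölder norms with the operator-norm bounds. -/

section NormComparison

variable {n : ℕ}

theorem tensorNorm_nonneg {j : ℕ} (T : E n [×j]→L[ℝ] ℝ) : 0 ≤ tensorNorm T := Real.sqrt_nonneg _

theorem abs_apply_single_le_tensorNorm {j : ℕ} (T : E n [×j]→L[ℝ] ℝ) (I : Fin j → Fin n) :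
    |T fun i => EuclideanSpace.single (I i) (1 : ℝ)| ≤ tensorNorm T := by
  refine Real.abs_le_sqrt ?_
  exact Finset.single_le_sum
    (f := fun I : Fin j → Fin n => (T fun i => EuclideanSpace.single (I i) (1 : ℝ)) ^ 2)
    (fun I _ => sq_nonneg _) (Finset.mem_univ I)

theorem tensorNorm_le {j : ℕ} (T : E n [×j]→L[ℝ] ℝ) : tensorNorm T ≤ n ^ j * ‖T‖ := by
  have h1 : ∀ I : Fin j → Fin n, |T fun i => EuclideanSpace.single (I i) (1 : ℝ)| ≤ ‖T‖ := by
    intro I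
    simpa using T.le_opNorm fun i => EuclideanSpace.single (I i) (1 : ℝ)
  calc tensorNorm T
      ≤ ∑ I : Fin j → Fin n, |T fun i => EuclideanSpace.single (I i) (1 : ℝ)| := by
        refine Real.sqrt_le_iff.2 ⟨Finset.sum_nonneg fun I _ => abs_nonneg _, ?_⟩
        have := Finset.sum_sq_le_sq_sum_of_nonneg (s := Finset.univ)
          (f := fun I : Fin j → Fin n => |T fun i => EuclideanSpace.single (I i) (1 : ℝ)|)
          (fun I _ => abs_nonneg _)
        simpa using this
    _ ≤ ∑ _I : Fin j → Fin n, ‖T‖ := Finset.sum_le_sum fun I _ => h1 I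
    _ = _ := by simp

theorem norm_le_tensorNorm {j : ℕ} (T : E n [×j]→L[ℝ] ℝ) : ‖T‖ ≤ n ^ j * tensorNorm T := by
  refine T.opNorm_le_bound (mul_nonneg (by positivity) (tensorNorm_nonneg T)) fun v => ?_
  have hv : v = fun i => ∑ a : Fin n, v i a • (EuclideanSpace.single a (1 : ℝ) : E n) := by
    funext i
    have := (EuclideanSpace.basisFun (Fin n) ℝ).sum_repr (v i)
    simpa using this.symm
  have hT : T v = ∑ I : Fin j → Fin n,
      (∏ i, v i (I i)) * T fun i => EuclideanSpace.single (I i) (1 : ℝ) := by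
    conv_lhs => rw [hv]
    rw [ContinuousMultilinearMap.map_sum]
    refine Finset.sum_congr rfl fun I _ => ?_
    rw [ContinuousMultilinearMap.map_smul_univ, smul_eq_mul]
  rw [hT]
  refine (norm_sum_le _ _).trans ?_
  calc ∑ I : Fin j → Fin n, ‖(∏ i, v i (I i)) * T fun i => EuclideanSpace.single (I i) (1 : ℝ)‖
      ≤ ∑ _I : Fin j → Fin n, (∏ i, ‖v i‖) * tensorNorm T := by
        refine Finset.sum_le_sum fun I _ => ?_
        rw [norm_mul, norm_prod]
        refine mul_le_mul (Finset.prod_le_prod (fun i _ => norm_nonneg _) fun i _ => ?_)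
          (abs_apply_single_le_tensorNorm T I) (norm_nonneg _)
          (Finset.prod_nonneg fun i _ => norm_nonneg _)
        exact PiLp.norm_apply_le (v i) (I i)
    _ = _ := by simp; ring

/-- A radius function is comparable to `1 + |x|`. -/
theorem IsRadiusFunction.exists_comparable {ρ : E n → ℝ} (hn : 1 ≤ n) (hρ : IsRadiusFunction ρ) :
    ∃ c, 1 ≤ c ∧ ∀ x, ρ x ≤ c * bracket x ∧ bracket x ≤ c * ρ x := by
  obtain ⟨R, hR0, hR⟩ := hρ.asymptotic
  obtain ⟨K, hK0, hK⟩ := hR 0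
  have hn' : (1 : ℝ) ≤ n := by exact_mod_cast hn
  obtain ⟨B, hB⟩ := (isCompact_closedBall (0 : E n) R).exists_bound_of_continuousOn
    (f := fun x => ρ x - ‖x‖) (hρ.contDiff.continuous.sub continuous_norm).continuousOn
  -- Only the order-zero asymptotic matters here: outside the ball it bounds the difference since `1
  -- - n ≤ 0`, inside compactness does.
  have hD : ∃ D, 0 ≤ D ∧ ∀ x, |ρ x - ‖x‖| ≤ D := by
    refine ⟨max B 0 + K * R ^ (1 - (n : ℝ)), by positivity, fun x => ?_⟩
    have h0 : 0 ≤ K * R ^ (1 - (n : ℝ)) := by positivity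
    rcases le_or_gt ‖x‖ R with hx | hx
    · have := hB x (by simpa using hx)
      rw [Real.norm_eq_abs] at this
      have := le_max_left B 0
      linarith
    · have h1 := hK x hx
      have h2 : tensorNorm (iteratedFDeriv ℝ 0 (fun y : E n => ρ y - ‖y‖) x) = |ρ x - ‖x‖| := by
        simp [tensorNorm, Real.sqrt_sq_eq_abs]
      rw [h2] at h1
      have h3 : ‖x‖ ^ (1 - (n : ℝ) - ((0 : ℕ) : ℝ)) ≤ R ^ (1 - (n : ℝ)) := by
        rw [Nat.cast_zero, sub_zero]
        exact Real.rpow_le_rpow_of_nonpos hR0 hx.le (by linarith)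
      have := le_max_right B 0
      have := mul_le_mul_of_nonneg_left h3 hK0.le
      linarith
  obtain ⟨D, hD0, hD⟩ := hD
  refine ⟨2 + D, by linarith, fun x => ?_⟩
  have h1 := abs_le.1 (hD x)
  have h2 := hρ.one_le x
  have h3 := norm_nonneg x
  unfold bracket
  constructor
  · nlinarith
  · nlinarith

variable {ρ : E n → ℝ}

theorem ofReal_le_weightedCkNorm {k : ℕ} {β : ℝ} {f : E n → ℝ} {j : ℕ} (hj : j ≤ k) (x : E n) :
    ENNReal.ofReal (ρ x ^ ((j : ℝ) - β) * tensorNorm (iteratedFDeriv ℝ j f x)) ≤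
      weightedCkNorm ρ k β f := by
  refine le_trans ?_ (Finset.single_le_sum
    (f := fun j : ℕ => ⨆ x : E n,
      ENNReal.ofReal (ρ x ^ ((j : ℝ) - β) * tensorNorm (iteratedFDeriv ℝ j f x)))
    (fun _ _ => zero_le) (Finset.mem_range.2 (Nat.lt_succ_of_le hj)))
  exact le_iSup (fun x : E n =>
    ENNReal.ofReal (ρ x ^ ((j : ℝ) - β) * tensorNorm (iteratedFDeriv ℝ j f x))) x

theorem exists_holderBound_of_mem (hn : 1 ≤ n) (hρ : IsRadiusFunction ρ) (k : ℕ) (α β : ℝ) :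
    ∃ C, 0 < C ∧ ∀ f ∈ weightedHolderSpace ρ k α β,
      HolderBound k α β (C * (weightedHolderNorm ρ k α β f).toReal) f := by
  obtain ⟨c, hc1, hc⟩ := hρ.exists_comparable hn
  have hc0 : 0 < c := by linarith
  have hn' : (1 : ℝ) ≤ n := by exact_mod_cast hn
  set A : ℝ := n ^ k * c ^ (|β| + k) with hA
  set A' : ℝ := n ^ k * (2 * c) ^ |β - k - α| with hA'
  refine ⟨A + A', by positivity, fun f hf => ?_⟩
  obtain ⟨hfc, hfin⟩ := hf
  set m := (weightedHolderNorm ρ k α β f).toReal with hm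
  have hm0 : 0 ≤ m := ENNReal.toReal_nonneg
  have hofm : ENNReal.ofReal m = weightedHolderNorm ρ k α β f := ENNReal.ofReal_toReal hfin.ne
  have hρ0 : ∀ x, 0 < ρ x := fun x => one_pos.trans_le (hρ.one_le x)
  have hAA : 0 < A ∧ 0 < A' := ⟨by positivity, by positivity⟩
  refine ⟨by exact_mod_cast hfc, fun j hj x => ?_, fun x y hxy => ?_⟩
  · have h1 : ρ x ^ ((j : ℝ) - β) * tensorNorm (iteratedFDeriv ℝ j f x) ≤ m := by
      rw [← ENNReal.ofReal_le_ofReal_iff hm0, hofm]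
      exact (ofReal_le_weightedCkNorm hj x).trans le_self_add
    have h2 : tensorNorm (iteratedFDeriv ℝ j f x) ≤ m * ρ x ^ (β - j) := by
      rw [← neg_sub, Real.rpow_neg (hρ0 x).le] at h1
      rwa [inv_mul_le_iff₀ (Real.rpow_pos_of_pos (hρ0 x) _), mul_comm] at h1
    have h3 : ρ x ^ (β - j) ≤ c ^ |β - j| * bracket x ^ (β - j) :=
      rpow_le_of_comparable (hρ0 x) (bracket_pos x) hc0 (hc x).1 (hc x).2 _
    have hb := bracket_pos x
    have h4 : c ^ |β - j| ≤ c ^ (|β| + k) := by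
      refine Real.rpow_le_rpow_of_exponent_le hc1 ((abs_sub _ _).trans ?_)
      have : (j : ℝ) ≤ k := by exact_mod_cast hj
      rw [Nat.abs_cast]
      linarith
    have h5 : (n : ℝ) ^ j ≤ n ^ k := pow_le_pow_right₀ hn' hj
    calc ‖iteratedFDeriv ℝ j f x‖ ≤ n ^ j * tensorNorm (iteratedFDeriv ℝ j f x) :=
          norm_le_tensorNorm _
      _ ≤ n ^ k * (m * (c ^ (|β| + k) * bracket x ^ (β - j))) := by
          have := tensorNorm_nonneg (iteratedFDeriv ℝ j f x)
          refine mul_le_mul h5 (h2.trans ?_) this (by positivity)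
          refine mul_le_mul_of_nonneg_left (h3.trans ?_) hm0
          gcongr
      _ = A * m * bracket x ^ (β - j) := by rw [hA]; ring
      _ ≤ _ := by
          gcongr
          linarith [hAA.2]
  · have hb := bracket_pos x
    rcases eq_or_ne x y with rfl | hne
    · rw [sub_self, norm_zero]
      have := hAA
      positivity
    set γ := β - k - α with hγ
    set T := iteratedFDeriv ℝ k f x - iteratedFDeriv ℝ k f y with hT
    have hd : 0 < ‖x - y‖ := norm_pos_iff.2 (sub_ne_zero.2 hne)
    have hdα : 0 < ‖x - y‖ ^ α := Real.rpow_pos_of_pos hd _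
    obtain ⟨hy1, hy2⟩ := bracket_le_of_near hxy
    set r := min (ρ x) (ρ y) with hr
    have hr0 : 0 < r := lt_min (hρ0 x) (hρ0 y)
    have h1 : r ^ (-γ) * (tensorNorm T / ‖x - y‖ ^ α) ≤ m := by
      rw [← ENNReal.ofReal_le_ofReal_iff hm0, hofm, ← dist_eq_norm]
      refine le_trans ?_ le_add_self
      unfold weightedHolderSeminorm
      exact le_iSup_of_le x (le_iSup_of_le y (le_iSup_of_le hne le_rfl))
    have h2 : tensorNorm T ≤ m * r ^ γ * ‖x - y‖ ^ α := by
      rw [Real.rpow_neg hr0.le, inv_mul_le_iff₀ (by positivity), div_le_iff₀ hdα] at h1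
      linarith
    have h3 : r ^ γ ≤ (2 * c) ^ |γ| * bracket x ^ γ := by
      refine rpow_le_of_comparable hr0 hb (by positivity) ?_ ?_ _
      · have := min_le_left (ρ x) (ρ y)
        have := (hc x).1
        nlinarith
      · rcases min_choice (ρ x) (ρ y) with h | h
        · rw [hr, h]
          have := (hc x).2
          have := mul_pos hc0 (hρ0 x)
          nlinarith
        · rw [hr, h]
          have := (hc y).2
          have := mul_pos hc0 (hρ0 y)
          nlinarith
    calc ‖T‖ ≤ n ^ k * tensorNorm T := norm_le_tensorNorm _
      _ ≤ n ^ k * (m * ((2 * c) ^ |γ| * bracket x ^ γ) * ‖x - y‖ ^ α) := by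
          refine mul_le_mul_of_nonneg_left (h2.trans ?_) (by positivity)
          gcongr
      _ = A' * m * bracket x ^ γ * ‖x - y‖ ^ α := by rw [hA']; ring
      _ ≤ _ := by
          gcongr
          linarith [hAA.1]

/-- The seminorm ranges over all pairs, while `HolderBound` only constrains close ones. Distant
pairs are handled by the pointwise bound of order `k`; `β ≤ 0` makes all the powers involved
monotone in the smaller weight. -/
theorem exists_weightedHolderNorm_le (hn : 1 ≤ n) (hρ : IsRadiusFunction ρ) (k : ℕ) {α β : ℝ}
    (hα : 0 < α) (hβ : β ≤ 0) :
    ∃ C, 0 < C ∧ ∀ (u : E n → ℝ) (M : ℝ), HolderBound k α β M u →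
      weightedHolderNorm ρ k α β u ≤ ENNReal.ofReal (C * M) := by
  obtain ⟨c, hc1, hc⟩ := hρ.exists_comparable hn
  have hc0 : 0 < c := by linarith
  have hn' : (1 : ℝ) ≤ n := by exact_mod_cast hn
  have hρ0 : ∀ x, 0 < ρ x := fun x => one_pos.trans_le (hρ.one_le x)
  set A : ℝ := n ^ k * c ^ (|β| + k) with hA
  set A' : ℝ := n ^ k * c ^ (-(β - k - α)) * (2 * 4 ^ α) with hA'
  have hA0 : 0 < A := by positivity
  have hA'0 : 0 < A' := by positivity
  refine ⟨(k + 1) * A + A', by positivity, fun u M hu => ?_⟩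
  have hM := hu.nonneg
  have hk0 : (0 : ℝ) ≤ k := Nat.cast_nonneg k
  rw [add_mul, ENNReal.ofReal_add (by positivity) (by positivity)]
  refine add_le_add ?_ ?_
  · unfold weightedCkNorm
    calc _ ≤ ∑ _j ∈ Finset.range (k + 1), ENNReal.ofReal (A * M) := by
          refine Finset.sum_le_sum fun j hj => iSup_le fun x => ENNReal.ofReal_le_ofReal ?_
          have hj' : j ≤ k := Nat.lt_succ_iff.1 (Finset.mem_range.1 hj)
          have hjk : (j : ℝ) ≤ k := by exact_mod_cast hj'
          have hb := bracket_pos x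
          have h3 : ρ x ^ ((j : ℝ) - β) ≤ c ^ |(j : ℝ) - β| * bracket x ^ ((j : ℝ) - β) :=
            rpow_le_of_comparable (hρ0 x) hb hc0 (hc x).1 (hc x).2 _
          have h4 : c ^ |(j : ℝ) - β| ≤ c ^ (|β| + k) := by
            refine Real.rpow_le_rpow_of_exponent_le hc1 ((abs_sub _ _).trans ?_)
            rw [Nat.abs_cast]
            linarith
          have h5 : (n : ℝ) ^ j ≤ n ^ k := pow_le_pow_right₀ hn' hj'
          have h6 : tensorNorm (iteratedFDeriv ℝ j u x) ≤ n ^ k * (M * bracket x ^ (β - j)) :=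
            (tensorNorm_le _).trans
              (mul_le_mul h5 (hu.bound j hj' x) (norm_nonneg _) (by positivity))
          have e : bracket x ^ ((j : ℝ) - β) * bracket x ^ (β - j) = 1 := by
            rw [← Real.rpow_add hb]; simp
          calc _ ≤ c ^ (|β| + k) * bracket x ^ ((j : ℝ) - β) *
                (n ^ k * (M * bracket x ^ (β - j))) := by
                refine mul_le_mul (h3.trans ?_) h6 (tensorNorm_nonneg _) (by positivity)
                gcongr
            _ = A * M * (bracket x ^ ((j : ℝ) - β) * bracket x ^ (β - j)) := by rw [hA]; ring
            _ = A * M := by rw [e, mul_one]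
      _ = ENNReal.ofReal ((k + 1) * A * M) := by
          rw [Finset.sum_const, Finset.card_range, nsmul_eq_mul, mul_assoc (k + 1 : ℝ),
            ENNReal.ofReal_mul (p := (k + 1 : ℝ)) (by positivity), ← Nat.cast_succ,
            ENNReal.ofReal_natCast]
  · unfold weightedHolderSeminorm
    refine iSup_le fun x => iSup_le fun y => iSup_le fun hne => ENNReal.ofReal_le_ofReal ?_
    set γ := β - k - α with hγ
    have hγ0 : 0 ≤ -γ := by linarith
    set T := iteratedFDeriv ℝ k u x - iteratedFDeriv ℝ k u y with hT
    have hbx := bracket_pos x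
    have hby := bracket_pos y
    set b := min (bracket x) (bracket y) with hb
    have hb0 : 0 < b := lt_min hbx hby
    have hd : 0 < dist x y := dist_pos.2 hne
    have hdα : 0 < dist x y ^ α := Real.rpow_pos_of_pos hd _
    have h4α : (1 : ℝ) ≤ 4 ^ α := Real.one_le_rpow (by norm_num) hα.le
    have h1 : min (ρ x) (ρ y) ^ (-γ) ≤ c ^ (-γ) * b ^ (-γ) := by
      rw [← Real.mul_rpow hc0.le hb0.le]
      refine Real.rpow_le_rpow (lt_min (hρ0 x) (hρ0 y)).le ?_ hγ0
      rw [hb, mul_min_of_nonneg _ _ hc0.le]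
      exact min_le_min (hc x).1 (hc y).1
    have hmain : ‖T‖ ≤ 2 * 4 ^ α * M * b ^ γ * dist x y ^ α := by
      rcases le_or_gt ‖x - y‖ (bracket x / 4) with hxy | hxy
      · have h2 := hu.holder x y hxy
        rw [← dist_eq_norm x y] at h2
        have h3 : bracket x ^ γ ≤ b ^ γ :=
          Real.rpow_le_rpow_of_nonpos hb0 (min_le_left _ _) (by linarith)
        refine h2.trans ?_
        gcongr
        nlinarith
      · have h2 : ∀ z, b ≤ bracket z → ‖iteratedFDeriv ℝ k u z‖ ≤ M * b ^ (β - k) := by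
          intro z hz
          refine (hu.bound k le_rfl z).trans ?_
          refine mul_le_mul_of_nonneg_left ?_ hM
          exact Real.rpow_le_rpow_of_nonpos hb0 hz (by linarith)
        -- For distant points the separation exceeds a quarter of the smaller weight, so a power of
        -- the weight can be paid for by the distance.
        have h3 : b ^ α ≤ 4 ^ α * dist x y ^ α := by
          rw [← Real.mul_rpow (by norm_num) hd.le]
          refine Real.rpow_le_rpow hb0.le ?_ hα.le
          rw [dist_eq_norm]
          have := min_le_left (bracket x) (bracket y)
          linarith
        have e : b ^ (β - k) = b ^ γ * b ^ α := by
          rw [← Real.rpow_add hb0, hγ]; ring_nf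
        calc ‖T‖ ≤ ‖iteratedFDeriv ℝ k u x‖ + ‖iteratedFDeriv ℝ k u y‖ := norm_sub_le _ _
          _ ≤ M * b ^ (β - k) + M * b ^ (β - k) :=
              add_le_add (h2 x (min_le_left _ _)) (h2 y (min_le_right _ _))
          _ = 2 * M * b ^ γ * b ^ α := by rw [e]; ring
          _ ≤ 2 * M * b ^ γ * (4 ^ α * dist x y ^ α) := by gcongr
          _ = _ := by ring
    have e : b ^ (-γ) * b ^ γ = 1 := by
      rw [← Real.rpow_add hb0]; simp
    calc _ ≤ c ^ (-γ) * b ^ (-γ) * (n ^ k * (2 * 4 ^ α * M * b ^ γ)) := by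
          refine mul_le_mul h1 ?_ (div_nonneg (tensorNorm_nonneg _) hdα.le) (by positivity)
          rw [div_le_iff₀ hdα]
          refine (tensorNorm_le T).trans ?_
          rw [mul_assoc]
          exact mul_le_mul_of_nonneg_left hmain (by positivity)
      _ = A' * M * (b ^ (-γ) * b ^ γ) := by rw [hA']; ring
      _ = A' * M := by rw [e, mul_one]

end NormComparison

/-! ### The maximum principle and uniqueness. -/

section MaximumPrinciple

variable {n : ℕ}

theorem iteratedFDeriv_two_nonpos_of_isLocalMax {v : E n → ℝ} (hv : ContDiff ℝ 2 v) {p : E n}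
    (hp : IsLocalMax v p) (e : E n) : iteratedFDeriv ℝ 2 v p ![e, e] ≤ 0 := by
  by_contra! hpos
  set g : ℝ → ℝ := fun t => v (p + t • e) with hg
  have hline : ∀ t : ℝ, HasDerivAt (fun t : ℝ => p + t • e) e t := fun t => by
    simpa using ((hasDerivAt_id t).smul_const e).const_add p
  have hg1 : deriv g = fun t => fderiv ℝ v (p + t • e) e := funext fun t =>
    ((hv.differentiable two_ne_zero _).hasFDerivAt.comp_hasDerivAt t (hline t)).deriv
  have hdv : Differentiable ℝ (fderiv ℝ v) :=
    (hv.fderiv_right (m := 1) (by norm_num)).differentiable one_ne_zero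
  have hg2 : deriv (deriv g) 0 = iteratedFDeriv ℝ 2 v p ![e, e] := by
    have h0 : p + (0 : ℝ) • e = p := by simp
    have h1 := (hdv (p + (0 : ℝ) • e)).hasFDerivAt.comp_hasDerivAt (0 : ℝ) (hline 0)
    have h2 := (h1.clm_apply (hasDerivAt_const (0 : ℝ) e)).deriv
    rw [hg1, iteratedFDeriv_two_apply]
    simpa [h0, Function.comp_def] using h2
  have hcont : Continuous fun t : ℝ => p + t • e := by fun_prop
  have hmax : IsLocalMax g 0 := by
    have h3 : Filter.Tendsto (fun t : ℝ => p + t • e) (nhds 0) (nhds p) := by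
      simpa using hcont.tendsto 0
    have := h3.eventually hp
    filter_upwards [this] with t ht
    simpa [hg] using ht
  -- A positive second derivative makes the maximum a local minimum too, so `g` is locally constant
  -- and its second derivative vanishes.
  have hmin : IsLocalMin g 0 := isLocalMin_of_deriv_deriv_pos (by rw [hg2]; exact hpos)
    hmax.deriv_eq_zero (hv.continuous.comp hcont).continuousAt
  have hconst : g =ᶠ[nhds 0] fun _ => g 0 := by
    filter_upwards [hmax, hmin] with t h1 h2 using le_antisymm h1 h2
  have h4 : deriv (deriv g) 0 = 0 := by
    have h5 := hconst.deriv
    rw [deriv_const'] at h5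
    rw [h5.deriv_eq, deriv_const]
  rw [hg2] at h4
  exact hpos.ne' h4

theorem iteratedFDeriv_two_norm_sq (p e : E n) :
    iteratedFDeriv ℝ 2 (fun z : E n => ‖z‖ ^ 2) p ![e, e] = 2 * ‖e‖ ^ 2 := by
  let L : E n →L[ℝ] E n →L[ℝ] ℝ := (isBoundedBilinearMap_inner (𝕜 := ℝ)).toContinuousLinearMap
  have hL : ∀ z v, L z v = inner ℝ z v := fun _ _ => rfl
  have h1 : fderiv ℝ (fun z : E n => ‖z‖ ^ 2) = ⇑((2 : ℝ) • L) := by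
    funext z
    rw [(hasStrictFDerivAt_norm_sq z).hasFDerivAt.fderiv]
    ext v
    simp [hL]
  rw [iteratedFDeriv_two_apply, h1, ContinuousLinearMap.fderiv]
  simp [hL]

/-- A subharmonic function tending to zero at infinity is nonpositive. -/
theorem nonpos_of_trace_nonneg (hn : 1 ≤ n) {w : E n → ℝ} (hw : ContDiff ℝ 2 w)
    (htr : ∀ x, 0 ≤ traceCLM n (iteratedFDeriv ℝ 2 w x))
    (hlim : Filter.Tendsto w (Filter.cocompact (E n)) (nhds 0)) (x₀ : E n) : w x₀ ≤ 0 := by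
  by_contra! ha
  set a := w x₀ with hadef
  have hev : ∀ᶠ x in Filter.cocompact (E n), w x < a / 2 :=
    hlim.eventually (gt_mem_nhds (by positivity))
  obtain ⟨R₀, hR₀⟩ := (Metric.hasBasis_cobounded_compl_closedBall (0 : E n)).eventually_iff.1
    (by rw [Metric.cobounded_eq_cocompact]; exact hev)
  set R := max R₀ ‖x₀‖ + 1 with hR
  have hRpos : 0 < R := by positivity
  have hx₀R : ‖x₀‖ < R := by
    have := le_max_right R₀ ‖x₀‖
    linarith
  -- The perturbation `ε ‖z‖²` makes the trace strictly positive, yet adds only `a / 4` on the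
  -- sphere of radius `R`, where `w < a / 2`; the maximum, at least `a`, is therefore interior.
  set ε := a / (4 * R ^ 2) with hε
  have hε0 : 0 < ε := by positivity
  have hεR : ε * R ^ 2 = a / 4 := by rw [hε]; field_simp
  set v : E n → ℝ := fun z => w z + ε * ‖z‖ ^ 2 with hv
  have hsq : ContDiff ℝ 2 fun z : E n => ‖z‖ ^ 2 := contDiff_norm_sq ℝ
  have hvc : ContDiff ℝ 2 v := hw.add (contDiff_const.mul hsq)
  obtain ⟨p, hpB, hpmax⟩ := (isCompact_closedBall (0 : E n) R).exists_isMaxOn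
    ⟨0, by simp [hRpos.le]⟩ hvc.continuous.continuousOn
  have hvx₀ : a ≤ v p := by
    have h1 : v x₀ ≤ v p := hpmax (by simpa using hx₀R.le)
    have h2 : a ≤ v x₀ := by
      simp only [hv]
      have : 0 ≤ ε * ‖x₀‖ ^ 2 := by positivity
      linarith
    linarith
  have hpR : ‖p‖ < R := by
    have hple : ‖p‖ ≤ R := by simpa using hpB
    rcases hple.lt_or_eq with h | h
    · exact h
    · have h1 : w p < a / 2 := hR₀.2 (by
        simp only [Set.mem_compl_iff, mem_closedBall_zero_iff, not_le]
        have := le_max_left R₀ ‖x₀‖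
        linarith)
      simp only [hv, h, hεR] at hvx₀
      linarith
  have hloc : IsLocalMax v p := hpmax.isLocalMax
    (Filter.mem_of_superset (Metric.isOpen_ball.mem_nhds (by simpa using hpR))
      Metric.ball_subset_closedBall)
  have hsum : traceCLM n (iteratedFDeriv ℝ 2 v p) ≤ 0 := by
    rw [traceCLM_apply]
    exact Finset.sum_nonpos fun i _ => iteratedFDeriv_two_nonpos_of_isLocalMax hvc hloc _
  have hadd : iteratedFDeriv ℝ 2 v p = iteratedFDeriv ℝ 2 w p +
      ε • iteratedFDeriv ℝ 2 (fun z : E n => ‖z‖ ^ 2) p := by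
    rw [← iteratedFDeriv_const_smul_apply' hsq.contDiffAt,
      ← iteratedFDeriv_add_apply hw.contDiffAt (hsq.const_smul ε).contDiffAt]
    rfl
  have h2n : traceCLM n (iteratedFDeriv ℝ 2 (fun z : E n => ‖z‖ ^ 2) p) = 2 * n := by
    rw [traceCLM_apply]
    simp [iteratedFDeriv_two_norm_sq, mul_comm]
  rw [hadd, map_add, map_smul, h2n, smul_eq_mul] at hsum
  have h3 := htr p
  have hn' : (1 : ℝ) ≤ n := by exact_mod_cast hn
  have : 0 < ε * (2 * n) := by positivity
  linarith

theorem tendsto_zero_of_le_bracket {u : E n → ℝ} {M γ : ℝ} (hγ : γ < 0)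
    (h : ∀ y, ‖u y‖ ≤ M * bracket y ^ γ) :
    Filter.Tendsto u (Filter.cocompact (E n)) (nhds 0) := by
  have hb : Filter.Tendsto (bracket : E n → ℝ) (Filter.cocompact (E n)) Filter.atTop :=
    Filter.tendsto_atTop_add_const_left _ _ tendsto_norm_cocompact_atTop
  have h1 : Filter.Tendsto (fun y : E n => M * bracket y ^ γ) (Filter.cocompact (E n))
      (nhds 0) := by
    have := ((tendsto_rpow_neg_atTop (y := -γ) (by linarith)).comp hb).const_mul M
    simpa [Function.comp_def] using this
  exact squeeze_zero_norm h h1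

theorem eq_of_geomLaplacian_eq (hn : 1 ≤ n) {u v : E n → ℝ} (hu : ContDiff ℝ 2 u)
    (hv : ContDiff ℝ 2 v) (hu0 : Filter.Tendsto u (Filter.cocompact (E n)) (nhds 0))
    (hv0 : Filter.Tendsto v (Filter.cocompact (E n)) (nhds 0))
    (h : geomLaplacian u = geomLaplacian v) : u = v := by
  have key : ∀ {u v : E n → ℝ}, ContDiff ℝ 2 u → ContDiff ℝ 2 v →
      Filter.Tendsto u (Filter.cocompact (E n)) (nhds 0) →
      Filter.Tendsto v (Filter.cocompact (E n)) (nhds 0) →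
      geomLaplacian u = geomLaplacian v → ∀ x, u x ≤ v x := by
    intro u v hu hv hu0 hv0 h x
    have := nonpos_of_trace_nonneg hn (w := u - v) (hu.sub hv) (fun y => ?_)
      (sub_zero (0 : ℝ) ▸ hu0.sub hv0) x
    · simpa using this
    · rw [iteratedFDeriv_sub_apply hu.contDiffAt hv.contDiffAt, map_sub]
      have := congrFun h y
      rw [geomLaplacian_eq, geomLaplacian_eq, neg_inj] at this
      rw [this, sub_self]
  funext x
  exact le_antisymm (key hu hv hu0 hv0 h x) (key hv hu hv0 hu0 h.symm x)

end MaximumPrinciple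

/-! ### Necessity of the mean-zero condition. -/

section Flux

variable {n : ℕ}

theorem exists_isBump_apply_zero : ∃ φ : E n → ℝ, IsBump φ 1 ∧ φ 0 = 1 := by
  let b : ContDiffBump (0 : E n) := ⟨1 / 2, 1, by norm_num, by norm_num⟩
  refine ⟨b, ⟨b.contDiff, fun z hz => b.zero_of_le_dist ?_⟩, b.one_of_mem_closedBall ?_⟩
  · rw [dist_zero_right]
    exact le_of_lt hz
  · exact Metric.mem_closedBall_self b.rIn_pos.le

theorem mollify_geomLaplacian {φ : E n → ℝ} {r : ℝ} (hφ : IsBump φ r) {u : E n → ℝ}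
    (hu : ContDiff ℝ 2 u) (x : E n) :
    mollify φ (geomLaplacian u) x = -traceCLM n (iteratedFDeriv ℝ 2 (mollify φ u) x) := by
  have hu' : ContDiff ℝ (2 : ℕ) u := hu
  have hc : Continuous (iteratedFDeriv ℝ 2 u) := hu'.continuous_iteratedFDeriv le_rfl
  have hi : Integrable fun y => φ (x - y) • iteratedFDeriv ℝ 2 u y := by
    have hφc := hφ.contDiff.continuous
    refine Continuous.integrable_of_hasCompactSupport (by fun_prop) ?_
    have h1 : HasCompactSupport fun y => φ (x - y) :=
      hφ.hasCompactSupport.comp_homeomorph (Homeomorph.subLeft x)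
    exact h1.smul_right
  rw [iteratedFDeriv_mollify_right hφ 2 hu 2 le_rfl, mollify, mollify,
    ← ContinuousLinearMap.integral_comp_comm _ hi, ← integral_neg]
  refine integral_congr_ae (Filter.Eventually.of_forall fun y => ?_)
  simp only [geomLaplacian_eq, map_smul, smul_eq_mul]
  ring

/-- The Laplacian of a function decaying faster than `|x|^(2-n)` has integral zero. -/
theorem integral_geomLaplacian_eq_zero (hn : 2 < n) {u : E n → ℝ} {M β : ℝ} (hu : ContDiff ℝ 2 u)
    (h1 : -1 - (n : ℝ) < β) (h2 : β < -(n : ℝ)) (huM : ∀ y, ‖u y‖ ≤ M * bracket y ^ (β + 2))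
    (hi : Integrable (geomLaplacian u)) : ∫ x, geomLaplacian u x = 0 := by
  have hn' : (3 : ℝ) ≤ n := by exact_mod_cast hn
  obtain ⟨φ, hφ, hφ0⟩ := exists_isBump_apply_zero (n := n)
  have hM : 0 ≤ M :=
    nonneg_of_mul_nonneg_left ((norm_nonneg _).trans (huM 0)) (Real.rpow_pos_of_pos (bracket_pos _) _)
  -- Since `β + 2 > 1 - n`, the decay of `u` falls in the range that requires no mean-zero
  -- condition.
  obtain ⟨C, -, hC⟩ := exists_far_bound_of_lt (n := n) (by omega) hφ 2 (β := β + 2)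
    (by linarith) (by linarith)
  have hbound : ∀ s : ℝ, 1 ≤ s → ‖∫ y, φ (s⁻¹ • (0 - y)) * geomLaplacian u y‖ ≤
      ‖traceCLM n‖ * (C * M) * s ^ (β + n) := by
    intro s hs
    have hs0 : 0 < s := by linarith
    -- The cutoff integral is `s ^ n` times a mollification at the origin, whose Laplacian decays
    -- like `s ^ β`.
    have e1 : ∫ y, φ (s⁻¹ • (0 - y)) * geomLaplacian u y =
        s ^ n * mollify (dilate φ s) (geomLaplacian u) 0 := by
      rw [mollify, ← integral_const_mul]
      refine integral_congr_ae (Filter.Eventually.of_forall fun y => ?_)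
      simp only [dilate, smul_eq_mul]
      field_simp
    rw [e1, mollify_geomLaplacian (hφ.dilate hs0) hu, norm_mul, norm_neg,
      Real.norm_of_nonneg (by positivity : 0 ≤ s ^ n)]
    have h3 := hC u M hu.continuous hM huM 0 s hs0 (by simp [bracket]; linarith)
    calc _ ≤ s ^ n * (‖traceCLM n‖ * (C * M * s ^ (β + 2 - (2 : ℕ)))) := by
          gcongr
          refine ((traceCLM n).le_opNorm _).trans ?_
          gcongr
      _ = ‖traceCLM n‖ * (C * M) * (s ^ (β + 2 - (2 : ℕ)) * s ^ n) := by ring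
      _ = _ := by
          rw [← Real.rpow_natCast s n, ← Real.rpow_add hs0]
          push_cast
          ring_nf
  have hlim0 : Filter.Tendsto (fun s : ℝ => ∫ y, φ (s⁻¹ • (0 - y)) * geomLaplacian u y)
      Filter.atTop (nhds 0) := by
    have := (tendsto_rpow_neg_atTop (y := -(β + n)) (by linarith)).const_mul
      (‖traceCLM n‖ * (C * M))
    rw [neg_neg, mul_zero] at this
    exact squeeze_zero_norm' ((Filter.eventually_ge_atTop 1).mono hbound) this
  have hlim1 : Filter.Tendsto (fun s : ℝ => ∫ y, φ (s⁻¹ • (0 - y)) * geomLaplacian u y)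
      Filter.atTop (nhds (∫ y, geomLaplacian u y)) := by
    obtain ⟨B, hB0, hB⟩ := hφ.exists_bound 0
    have hφc := hφ.contDiff.continuous
    refine tendsto_integral_filter_of_dominated_convergence
      (fun y => B * ‖geomLaplacian u y‖) ?_ ?_ (hi.norm.const_mul B) ?_
    · exact Filter.Eventually.of_forall fun s =>
        (Continuous.aestronglyMeasurable (by fun_prop)).mul hi.aestronglyMeasurable
    · refine Filter.Eventually.of_forall fun s => Filter.Eventually.of_forall fun y => ?_
      rw [norm_mul]
      gcongr
      simpa using hB (s⁻¹ • (0 - y))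
    · refine Filter.Eventually.of_forall fun y => ?_
      have h3 : Filter.Tendsto (fun s : ℝ => s⁻¹ • (0 - y)) Filter.atTop (nhds 0) := by
        simpa using (tendsto_inv_atTop_zero (𝕜 := ℝ)).smul_const (0 - y)
      have h4 := ((hφc.tendsto 0).comp h3).mul_const (geomLaplacian u y)
      simpa [hφ0] using h4
  exact tendsto_nhds_unique hlim1 hlim0

end Flux

/-! ### Existence, uniqueness and integrability in the weighted spaces. -/

section Main

variable {n k : ℕ} {α β : ℝ} {ρ : E n → ℝ}

theorem contDiff_two_of_mem {u : E n → ℝ} (hu : u ∈ weightedHolderSpace ρ (k + 2) α (β + 2)) :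
    ContDiff ℝ 2 u := by
  have h : (((2 : ℕ) : ℕ∞) : ℕ∞ω) ≤ ((k + 2 : ℕ) : ℕ∞) := by exact_mod_cast Nat.le_add_left 2 k
  exact_mod_cast hu.1.of_le h

theorem eq_of_mem_of_geomLaplacian_eq (hn : 1 ≤ n) (hρ : IsRadiusFunction ρ) (hβ : β < -2)
    {u v : E n → ℝ} (hu : u ∈ weightedHolderSpace ρ (k + 2) α (β + 2))
    (hv : v ∈ weightedHolderSpace ρ (k + 2) α (β + 2))
    (h : geomLaplacian u = geomLaplacian v) : u = v := by
  obtain ⟨C, -, hC⟩ := exists_holderBound_of_mem hn hρ (k + 2) α (β + 2)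
  exact eq_of_geomLaplacian_eq hn (contDiff_two_of_mem hu) (contDiff_two_of_mem hv)
    (tendsto_zero_of_le_bracket (by linarith) (hC u hu).norm_le)
    (tendsto_zero_of_le_bracket (by linarith) (hC v hv).norm_le) h

theorem integrable_of_mem (hn : 1 ≤ n) (hρ : IsRadiusFunction ρ) (hβ : β < -(n : ℝ)) {f : E n → ℝ}
    (hf : f ∈ weightedHolderSpace ρ k α β) : Integrable f := by
  obtain ⟨C, -, hC⟩ := exists_holderBound_of_mem hn hρ k α β
  exact integrable_of_le_bracket (hC f hf).contDiff.continuous (hC f hf).norm_le hβ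

theorem integral_eq_zero_of_mem (hn : 2 < n) (hρ : IsRadiusFunction ρ) (h1 : -1 - (n : ℝ) < β)
    (h2 : β < -(n : ℝ)) {f u : E n → ℝ} (hf : f ∈ weightedHolderSpace ρ k α β)
    (hu : u ∈ weightedHolderSpace ρ (k + 2) α (β + 2)) (h : geomLaplacian u = f) :
    ∫ x, f x = 0 := by
  obtain ⟨C, -, hC⟩ := exists_holderBound_of_mem (by omega) hρ (k + 2) α (β + 2)
  have hi := integrable_of_mem (by omega) hρ h2 hf
  subst h
  exact integral_geomLaplacian_eq_zero hn (contDiff_two_of_mem hu) h1 h2 (hC u hu).norm_le hi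

theorem exists_solution (hn : 2 < n) (hα : α ∈ Set.Ioo (0 : ℝ) 1) (hρ : IsRadiusFunction ρ)
    (h1 : -1 - (n : ℝ) < β) (h0 : β < -2) (hne : β ≠ -(n : ℝ)) :
    ∃ C : ℝ≥0, 0 < C ∧ ∀ f ∈ weightedHolderSpace ρ k α β, (β < -(n : ℝ) → ∫ y, f y = 0) →
      ∃ u ∈ weightedHolderSpace ρ (k + 2) α (β + 2), geomLaplacian u = f ∧
        weightedHolderNorm ρ (k + 2) α (β + 2) u ≤ C * weightedHolderNorm ρ k α β f := by
  obtain ⟨φ, η, hφη⟩ := exists_isKernelPair (n := n) (by omega)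
  obtain ⟨A, hA0, hA⟩ := exists_holderBound_of_mem (by omega) hρ k α β
  obtain ⟨B, hB0, hB⟩ := exists_potential_holderBound (k := k) (by omega) hα hφη.left h1 h0 hne
  obtain ⟨D, hD0, hD⟩ := exists_weightedHolderNorm_le (by omega) hρ (k + 2) (β := β + 2) hα.1
    (by linarith)
  refine ⟨(D * B * A).toNNReal, Real.toNNReal_pos.2 (by positivity), fun f hf hf0 => ?_⟩
  have hfb := hA f hf
  have hub := (hB f _ hfb hf0).1
  have hnorm : weightedHolderNorm ρ (k + 2) α (β + 2) (potential φ f) ≤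
      ENNReal.ofReal (D * B * A) * weightedHolderNorm ρ k α β f := by
    refine (hD _ _ hub).trans (le_of_eq ?_)
    rw [← mul_assoc, ← mul_assoc, ENNReal.ofReal_mul (by positivity),
      ENNReal.ofReal_toReal hf.2.ne]
  refine ⟨potential φ f, ⟨by exact_mod_cast hub.contDiff, ?_⟩,
    geomLaplacian_potential (by omega) hα hφη h1 h0 hne hfb hf0, ?_⟩
  · exact hnorm.trans_lt (ENNReal.mul_lt_top ENNReal.ofReal_lt_top hf.2)
  · exact hnorm

end Main

end WeightedHolder

theorem theorem4p4 (n k : ℕ) (hn : 2 < n) (α : ℝ) (hα : α ∈ Set.Ioo (0 : ℝ) 1)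
    (ρ : WeightedHolder.E n → ℝ) (hρ : WeightedHolder.IsRadiusFunction ρ) :
    (∀ β ∈ Set.Ioo (-(n : ℝ)) (-2),
      (∀ f ∈ WeightedHolder.weightedHolderSpace ρ k α β,
        ∃! u : WeightedHolder.E n → ℝ,
          u ∈ WeightedHolder.weightedHolderSpace ρ (k + 2) α (β + 2) ∧
            WeightedHolder.geomLaplacian u = f) ∧
      ∃ C : ℝ≥0, 0 < C ∧
        ∀ f ∈ WeightedHolder.weightedHolderSpace ρ k α β,
        ∀ u ∈ WeightedHolder.weightedHolderSpace ρ (k + 2) α (β + 2),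
          WeightedHolder.geomLaplacian u = f →
          WeightedHolder.weightedHolderNorm ρ (k + 2) α (β + 2) u ≤
            C * WeightedHolder.weightedHolderNorm ρ k α β f) ∧
    (∀ β ∈ Set.Ioo (-1 - (n : ℝ)) (-(n : ℝ)),
      (∀ f ∈ WeightedHolder.weightedHolderSpace ρ k α β,
        Integrable f ∧
        ((∃ u ∈ WeightedHolder.weightedHolderSpace ρ (k + 2) α (β + 2),
            WeightedHolder.geomLaplacian u = f) ↔ ∫ x, f x = 0) ∧
        ∀ u ∈ WeightedHolder.weightedHolderSpace ρ (k + 2) α (β + 2),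
        ∀ v ∈ WeightedHolder.weightedHolderSpace ρ (k + 2) α (β + 2),
          WeightedHolder.geomLaplacian u = f → WeightedHolder.geomLaplacian v = f → u = v) ∧
      ∃ C : ℝ≥0, 0 < C ∧
        ∀ f ∈ WeightedHolder.weightedHolderSpace ρ k α β,
        ∀ u ∈ WeightedHolder.weightedHolderSpace ρ (k + 2) α (β + 2),
          WeightedHolder.geomLaplacian u = f →
          WeightedHolder.weightedHolderNorm ρ (k + 2) α (β + 2) u ≤
            C * WeightedHolder.weightedHolderNorm ρ k α β f) := by
  refine ⟨fun β hβ => ?_, fun β hβ => ?_⟩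
  · obtain ⟨hβ1, hβ2⟩ := hβ
    obtain ⟨C, hC0, hC⟩ := WeightedHolder.exists_solution (k := k) hn hα hρ (β := β)
      (by linarith) hβ2 hβ1.ne'
    refine ⟨fun f hf => ?_, C, hC0, fun f hf u hu hfu => ?_⟩
    · obtain ⟨u, hu, hfu, -⟩ := hC f hf fun h => absurd h hβ1.not_gt
      exact ⟨u, ⟨hu, hfu⟩, fun v hv => WeightedHolder.eq_of_mem_of_geomLaplacian_eq (by omega) hρ
        hβ2 hv.1 hu (hv.2.trans hfu.symm)⟩
    -- Uniqueness identifies the given solution with the constructed one, whose norm is controlled.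
    · obtain ⟨v, hv, hfv, hnorm⟩ := hC f hf fun h => absurd h hβ1.not_gt
      rwa [WeightedHolder.eq_of_mem_of_geomLaplacian_eq (by omega) hρ hβ2 hu hv
        (hfu.trans hfv.symm)]
  · obtain ⟨hβ1, hβn⟩ := hβ
    have hβ2 : β < -2 := by
      have : (2 : ℝ) < n := by exact_mod_cast hn
      linarith
    obtain ⟨C, hC0, hC⟩ := WeightedHolder.exists_solution (k := k) hn hα hρ (β := β) hβ1 hβ2 hβn.ne
    refine ⟨fun f hf => ⟨WeightedHolder.integrable_of_mem (by omega) hρ hβn hf, ⟨?_, ?_⟩, ?_⟩,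
      C, hC0, fun f hf u hu hfu => ?_⟩
    · rintro ⟨u, hu, hfu⟩
      exact WeightedHolder.integral_eq_zero_of_mem hn hρ hβ1 hβn hf hu hfu
    · intro h
      obtain ⟨u, hu, hfu, -⟩ := hC f hf fun _ => h
      exact ⟨u, hu, hfu⟩
    · exact fun u hu v hv hfu hfv => WeightedHolder.eq_of_mem_of_geomLaplacian_eq (by omega) hρ
        hβ2 hu hv (hfu.trans hfv.symm)
    -- Solvability already forces mean zero, so the constructed solution is available for
    -- comparison.
    · obtain ⟨v, hv, hfv, hnorm⟩ := hC f hf fun _ =>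
        WeightedHolder.integral_eq_zero_of_mem hn hρ hβ1 hβn hf hu hfu
      rwa [WeightedHolder.eq_of_mem_of_geomLaplacian_eq (by omega) hρ hβ2 hu hv
        (hfu.trans hfv.symm)]
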